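/- **Setting.** Let $d\in\{1,2\}$. Let $V\subset\mathbb R^d$ be a set of sites such that the number of sites in a ball of radius $1$ is bounded, and write $|x-y|$ for the Euclidean distance. A Hubbard model on $V$ is given by real hopping amplitudes $t_{x,y}=t_{y,x}$ and real interactions $U_x$ ($x,y\in V$). Assume that the hoppings are bounded and of finite range: there are $R,T$ with $|t_{x,y}|\le T$ for all $x\ne y$, and $t_{x,y}=0$ whenever $x\neq y$ and $|x-y|>R$. For a finite set $\Lambda$ of sites, the Hamiltonian on the fermionic Fock space of dimension $4^{|\Lambda|}$ is $$H_\Lambda=\sum_{x,y\in\Lambda}\sum_{\sigma=\uparrow,\downarrow}t_{x,y}\,c^\dagger_{x,\sigma}c_{y,\sigma}+\sum_{x\in\Lambda}U_x\,n_{x,\uparrow}n_{x,\downarrow},\qquad n_{x,\sigma}=c^\dagger_{x,\sigma}c_{x,\sigma},$$ where $c_{x,\sigma},c^\dagger_{x,\sigma}$ are the annihilation and creation operators. The spin operators are $S^{(a)}_x=\frac12\sum_{\sigma,\tau}c^\dagger_{x,\sigma}(p^{(a)})_{\sigma,\tau}c_{x,\tau}$ with the Pauli matrices $p^{(a)}$,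 $a=1,2,3$, and $\mathbf S_x\cdot\mathbf S_y=\sum_{a}S^{(a)}_xS^{(a)}_y$. The canonical average with $N$ electrons at inverse temperature $\beta$ is $\langle A\rangle_{\Lambda,N,\beta}=\mathrm{Tr}_N[Ae^{-\beta H_\Lambda}]/\mathrm{Tr}_N[e^{-\beta H_\Lambda}]$, the traces being over the states with exactly $N$ electrons. The symbol $\langle A\rangle_\beta$ denotes any limit point of $\langle A\rangle_{\Lambda_n,N_n,\beta}$ as $n\to\infty$ (in particular the limit, if it exists), where $(\Lambda_n)$ is any sequence of finite subsets of $V$ that eventually contain each site, $0\le N_n\le2|\Lambda_n|$, and $H_{\Lambda_n}$ may be formed with any boundary conditions, that is, with real parameters $t^{(n)}_{x,y}=t^{(n)}_{y,x}$ and $U^{(n)}_x$ such that for each fixed site $x$ and all sufficiently large $n$ one has $U^{(n)}_x=U_x$ and $t^{(n)}_{x,y}=t_{x,y}$ for all $y\in\Lambda_n$. **Theorem (Koma–Tasaki bounds for correlations).** For every such model there are constants $\alpha,\gamma,\delta>0$ and a strictly decreasing function $f$ on $(0,\infty)$ with $$f(\beta)\sim\frac1\beta\quad(\beta\to\infty),\qquad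 f(\beta)\sim\frac2\delta|\ln\beta|\quad(\beta\to0^+),$$ where $\sim$ means that the ratio tends to $1$, such that for every $\beta>0$ there is $r_0$ (depending only on the model and on $\beta$) with the following property: for all sites $x,y$ with $|x-y|\ge r_0$ and all thermodynamic limits as above, $$\left|\left\langle c^\dagger_{x,\uparrow}c^\dagger_{x,\downarrow}c_{y,\uparrow}c_{y,\downarrow}+\text{H.c.}\right\rangle_\beta\right|\le\begin{cases}|x-y|^{-\alpha f(\beta)}&\text{if }d=2,\\ \exp[-\gamma f(\beta)|x-y|]&\text{if }d=1,\end{cases}$$ and $$\left|\langle\mathbf S_x\cdot\mathbf S_y\rangle_\beta\right|\le\begin{cases}|x-y|^{-\alpha f(\beta)}&\text{if }d=2,\\ \exp[-\gamma f(\beta)|x-y|]&\text{if }d=1.\end{cases}$$ -/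

import Mathlib

open Filter Topology Asymptotics

noncomputable section

namespace Fermion

/-! Fermionic operators over a finite set `ι` of modes. Fock space has the orthonormal basis
`|S⟩`, where the finite set `S` of occupied modes ranges over all subsets of `ι` (so its dimension
is `2 ^ |ι|`), and operators are written as matrices in this basis. -/

/-- Operators on the Fock space over the modes `ι`. -/
abbrev Op (ι : Type*) := Matrix (Finset ι) (Finset ι) ℂ

variable {ι : Type*} [Fintype ι] [DecidableEq ι]

/-- The Jordan-Wigner sign `(-1) ^ #{j ∈ S | j before i}`, for a fixed enumeration of the modes.
(Different enumerations give unitarily equivalent families of operators.) -/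
def sign (i : ι) (S : Finset ι) : ℂ :=
  (-1) ^ (S.filter fun j => Fintype.equivFin ι j < Fintype.equivFin ι i).card

/-- The annihilation operator: `c i |S⟩ = sign i S |S \ {i}⟩` if `i ∈ S`, and `c i |S⟩ = 0`
otherwise. The row index of the matrix is the final state, the column index the initial one. -/
def ann (i : ι) : Op ι := fun S' S => if i ∈ S ∧ S' = S.erase i then sign i S else 0

/-- The creation operator, the adjoint of the annihilation operator. -/
def cre (i : ι) : Op ι := (ann i).conjTranspose

/-- The trace of an operator over the subspace with exactly `N` particles. -/
def sectorTrace (N : ℕ) (A : Op ι) : ℂ :=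
  ∑ S ∈ Finset.univ.filter (fun S : Finset ι => S.card = N), A S S

/-- The canonical average of `A` at inverse temperature `β` and particle number `N` for the
Hamiltonian `H`. -/
def canonicalAverage (H : Op ι) (N : ℕ) (β : ℝ) (A : Op ι) : ℂ :=
  sectorTrace N (A * NormedSpace.exp (-(β : ℂ) • H)) /
    sectorTrace N (NormedSpace.exp (-(β : ℂ) • H))

end Fermion

namespace Hubbard

open Fermion

/-! Operators of the Hubbard model on a finite set `Λ` of sites. A mode is a pair of a site and a
spin; spin up is `0 : Fin 2` and spin down is `1 : Fin 2`. -/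

section Finite

variable {Λ : Type*} [Fintype Λ] [DecidableEq Λ]

/-- The number operator of site `x` and spin `σ`. -/
def num (x : Λ) (σ : Fin 2) : Op (Λ × Fin 2) := cre (x, σ) * ann (x, σ)

/-- The Hubbard Hamiltonian with hopping amplitudes `t` and on-site interaction `U`. -/
def hamiltonian (t : Λ → Λ → ℝ) (U : Λ → ℝ) : Op (Λ × Fin 2) :=
  (∑ x, ∑ y, ∑ σ : Fin 2, (t x y : ℂ) • (cre (x, σ) * ann (y, σ))) +
    ∑ x, (U x : ℂ) • (num x 0 * num x 1)

/-- The three Pauli matrices. -/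
def pauli : Fin 3 → Matrix (Fin 2) (Fin 2) ℂ :=
  ![!![0, 1; 1, 0], !![0, -Complex.I; Complex.I, 0], !![1, 0; 0, -1]]

/-- The component `a` of the spin operator at site `x`. -/
def spin (a : Fin 3) (x : Λ) : Op (Λ × Fin 2) :=
  (1 / 2 : ℂ) • ∑ σ : Fin 2, ∑ τ : Fin 2, pauli a σ τ • (cre (x, σ) * ann (x, τ))

/-- The scalar product of the spin operators at the sites `x` and `y`. -/
def spinDot (x y : Λ) : Op (Λ × Fin 2) := ∑ a : Fin 3, spin a x * spin a y

/-- The on-site pair operator `c†_{x↑} c†_{x↓} c_{y↑} c_{y↓}`, without its adjoint. -/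
def pairHop (x y : Λ) : Op (Λ × Fin 2) :=
  cre (x, 0) * cre (x, 1) * ann (y, 0) * ann (y, 1)

/-- The on-site pair operator plus its Hermitian conjugate. -/
def pairOp (x y : Λ) : Op (Λ × Fin 2) := pairHop x y + (pairHop x y).conjTranspose

end Finite

/-- A Hubbard model in `d` dimensions: sites placed at distinct points of `ℝ^d` such that the
number of sites in a ball of radius one is bounded (as for any crystal lattice), real symmetric
hopping amplitudes, and real on-site interactions. -/
structure Model (d : ℕ) (V : Type*) where
  pos : V → EuclideanSpace ℝ (Fin d)
  pos_injective : Function.Injective pos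
  bounded_density : ∃ K : ℕ, ∀ p, {v : V | dist (pos v) p ≤ 1}.encard ≤ K
  t : V → V → ℝ
  t_symm : ∀ x y, t x y = t y x
  U : V → ℝ

variable {d : ℕ} {V : Type*}

/-- The Euclidean distance of two sites. -/
def Model.siteDist (M : Model d V) (x y : V) : ℝ := dist (M.pos x) (M.pos y)

/-- The hoppings between distinct sites are bounded and of finite range. The single-body potential
`t x x` is not restricted. -/
def Model.FiniteRange (M : Model d V) : Prop :=
  ∃ R T : ℝ, ∀ x y, x ≠ y → |M.t x y| ≤ T ∧ (R < M.siteDist x y → M.t x y = 0)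

/-- The finite systems and electron numbers of a thermodynamic limit: finite sets of sites that
eventually contain every site, the number of electrons in each of them, and finite-volume
parameters that agree with those of the model away from the boundary. The last two
conditions admit all the usual boundary conditions (open, periodic, boundary fields). -/
structure FiniteVolumes (M : Model d V) where
  Λ : ℕ → Finset V
  exhausts : ∀ x, ∀ᶠ n in atTop, x ∈ Λ n
  N : ℕ → ℕ
  N_le : ∀ n, N n ≤ 2 * (Λ n).card
  t : ℕ → V → V → ℝ
  t_symm : ∀ n x y, t n x y = t n y x
  t_bulk : ∀ x, ∀ᶠ n in atTop, ∀ y ∈ Λ n, t n x y = M.t x y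
  U : ℕ → V → ℝ
  U_bulk : ∀ x, ∀ᶠ n in atTop, U n x = M.U x

namespace FiniteVolumes

variable {M : Model d V}

open Classical in
/-- The canonical average in the `n`-th finite system. -/
def average (F : FiniteVolumes M) (β : ℝ) (n : ℕ) (A : Op (F.Λ n × Fin 2)) : ℂ :=
  canonicalAverage (hamiltonian (fun x y : F.Λ n => F.t n x y) (fun x : F.Λ n => F.U n x))
    (F.N n) β A

open Classical in
/-- The on-site pair correlation in the `n`-th finite system. The value `0` is used for the
finitely many `n` for which a site is missing. -/
def pairCorr (F : FiniteVolumes M) (β : ℝ) (x y : V) (n : ℕ) : ℂ :=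
  if h : x ∈ F.Λ n ∧ y ∈ F.Λ n then F.average β n (pairOp ⟨x, h.1⟩ ⟨y, h.2⟩) else 0

open Classical in
/-- The spin correlation in the `n`-th finite system. -/
def spinCorr (F : FiniteVolumes M) (β : ℝ) (x y : V) (n : ℕ) : ℂ :=
  if h : x ∈ F.Λ n ∧ y ∈ F.Λ n then F.average β n (spinDot ⟨x, h.1⟩ ⟨y, h.2⟩) else 0

/-- `L` is a value of the thermodynamic limit of `u`: the limit, or, should the limit not exist,
the limit along a subsequence of the finite systems. -/
def IsThermodynamicLimit (u : ℕ → ℂ) (L : ℂ) : Prop := MapClusterPt L atTop u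

end FiniteVolumes

end Hubbard

end

/-!
Decay of correlations by the method of complex rotations (McBryan and Spencer, Koma and Tasaki).

Let `θ` assign a real number to each mode, and let `G = exp (∑ i, θ i n_i)`. Conjugation by `G`
multiplies an operator `A` of charge `q` by `exp q`, and turns the Hamiltonian `H` into `H'`, in
which the amplitude `t i j` is multiplied by `exp (θ i - θ j)`. As traces are invariant, the
average of `A` is `exp q` times the trace of `A exp (-β H')`, divided by the partition function.
The operator `H' - H` has an anti-Hermitian part with the factors `sinh (θ i - θ j)`, of first
order in the rotation, and a Hermitian part with the factors `cosh (θ i - θ j) - 1`, of second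
order. The trace inequality `Matrix.norm_trace_mul_exp_add_le` says that only the latter counts,
so that `|⟨A⟩| ≤ ‖A‖ exp (q + β ∑ |t i j| (cosh (θ i - θ j) - 1))`
(`Fermion.norm_canonicalAverage_le`). The inequality follows, by the Lie product formula, from the
two inequalities of `Matrix.norm_trace_pow_two_pow_le` for powers of matrices with exponents `2 ^
k`, which are iterated Cauchy-Schwarz inequalities. Everything commutes with the projection to a
fixed number of particles, so the inequality holds in each canonical ensemble.

Equal angles for the two spins give the charge `2 (φ x - φ y)` to the pair operator; opposite
angles give it to `S^+_x S^-_y`. The correlation of the third spin components is reduced to the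
latter by rotation invariance (`Hubbard.canonicalAverage_spin_two_mul_spin_two`).

It remains to choose the angles around `x`: with `r` the distance of `x` and `y`, and `s` that of
a site from `x`, they are `κ (ψ (min s r) - ψ r)`, where `ψ s = s` in one dimension and `ψ s = log
(1 + s)` in two. In both cases the gain is `2 κ ψ r` and the cost is of order `β κ² cosh (κ R) (ψ
r + 1)`. For `κ` a small multiple of `log (1 + 1 / β)` the cost is at most half of the gain at
every temperature, by the inequality `log w ≤ (w - 1) / √w`. As the angles vanish outside a ball,
the boundary conditions do not matter once the finite system is large.
-/

noncomputable section

set_option linter.unusedSectionVars false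

/-! ### Products of exponentials -/

section Trotter

variable {𝔸 : Type*} [NormedRing 𝔸]

theorem norm_pow_sub_pow_le_of_norm_le [NormOneClass 𝔸] {a b : 𝔸} {M : ℝ} (hM : 0 ≤ M)
    (ha : ‖a‖ ≤ M) (hb : ‖b‖ ≤ M) (n : ℕ) :
    ‖a ^ n - b ^ n‖ ≤ n * M ^ (n - 1) * ‖a - b‖ := by
  induction n with
  | zero => simp
  | succ n ih =>
    have key : a ^ (n + 1) - b ^ (n + 1) = a ^ n * (a - b) + (a ^ n - b ^ n) * b := by
      rw [pow_succ, pow_succ]; noncomm_ring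
    have h1 : ‖a ^ n‖ ≤ M ^ n := (norm_pow_le a n).trans (by gcongr)
    have h2 : (n : ℝ) * M ^ (n - 1) * M = n * M ^ n := by
      rcases n with _ | n
      · simp
      · simp [pow_succ, mul_assoc]
    calc ‖a ^ (n + 1) - b ^ (n + 1)‖ ≤ ‖a ^ n‖ * ‖a - b‖ + ‖a ^ n - b ^ n‖ * ‖b‖ := by
          rw [key]
          exact (norm_add_le _ _).trans (add_le_add (norm_mul_le _ _) (norm_mul_le _ _))
      _ ≤ M ^ n * ‖a - b‖ + n * M ^ (n - 1) * ‖a - b‖ * M := by gcongr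
      _ = (↑(n + 1) : ℝ) * M ^ (n + 1 - 1) * ‖a - b‖ := by
          rw [mul_right_comm, h2, Nat.add_sub_cancel]; push_cast; ring

variable [NormedAlgebra ℝ 𝔸] [CompleteSpace 𝔸]

theorem NormedSpace.norm_exp_le_exp_norm [NormOneClass 𝔸] (x : 𝔸) :
    ‖NormedSpace.exp x‖ ≤ Real.exp ‖x‖ := by
  have h1 := NormedSpace.exp_series_hasSum_exp' (𝕂 := ℝ) x
  have h2 := NormedSpace.exp_series_hasSum_exp' (𝕂 := ℝ) ‖x‖
  rw [← Real.exp_eq_exp_ℝ] at h2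
  refine h1.norm_le_of_bounded h2 fun n => ?_
  rw [norm_smul, smul_eq_mul]
  have : ‖((n.factorial : ℝ)⁻¹)‖ = ((n.factorial : ℝ)⁻¹) := by
    rw [Real.norm_of_nonneg]; positivity
  rw [this]
  gcongr
  exact norm_pow_le x n

/-- The Lie product formula: the first-order agreement of `exp (t X) exp (t Y)` and
`exp (t (X + Y))` at `t = 0` makes the error of each of the `n` factors `o(1 / n)`. -/
theorem tendsto_exp_smul_mul_exp_smul_pow [NormOneClass 𝔸] (X Y : 𝔸) :
    Tendsto (fun n : ℕ => (NormedSpace.exp ((n : ℝ)⁻¹ • X) * NormedSpace.exp ((n : ℝ)⁻¹ • Y)) ^ n)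
      atTop (𝓝 (NormedSpace.exp (X + Y))) := by
  set a : ℝ → 𝔸 := fun t => NormedSpace.exp (t • X) * NormedSpace.exp (t • Y)
  set b : ℝ → 𝔸 := fun t => NormedSpace.exp (t • (X + Y))
  have hderiv : HasDerivAt (fun t => a t - b t) 0 0 := by
    have hX := hasDerivAt_exp_smul_const (𝕂 := ℝ) X 0
    have hY := hasDerivAt_exp_smul_const (𝕂 := ℝ) Y 0
    have hXY := hasDerivAt_exp_smul_const (𝕂 := ℝ) (X + Y) 0
    have h : HasDerivAt (fun t => a t - b t) _ 0 := (hX.mul hY).sub hXY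
    convert h using 1
    simp
  have hlo : (fun t => a t - b t) =o[𝓝 0] fun t => t := by
    have := hderiv.isLittleO
    simpa [a, b] using this
  have hlim : Tendsto (fun n : ℕ => ((n : ℝ)⁻¹)) atTop (𝓝 0) := tendsto_inv_atTop_nhds_zero_nat
  have hlo' := hlo.comp_tendsto hlim
  set c := ‖X‖ + ‖Y‖
  have hexp : ∀ n : ℕ, n ≠ 0 → b (n : ℝ)⁻¹ ^ n = NormedSpace.exp (X + Y) := by
    intro n hn
    let _ : NormedAlgebra ℚ 𝔸 := .restrictScalars ℚ ℝ 𝔸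
    have hn' : (n : ℝ) ≠ 0 := by exact_mod_cast hn
    simp only [b]
    rw [← NormedSpace.exp_nsmul, ← Nat.cast_smul_eq_nsmul ℝ, smul_smul, mul_inv_cancel₀ hn',
      one_smul]
  have hbound : ∀ n : ℕ, n ≠ 0 → ‖a (n : ℝ)⁻¹ ^ n - b (n : ℝ)⁻¹ ^ n‖ ≤
      Real.exp c * (‖a (n : ℝ)⁻¹ - b (n : ℝ)⁻¹‖ / (n : ℝ)⁻¹) := by
    intro n hn
    have hn' : (0 : ℝ) < n := by positivity
    have hsm : ∀ Z : 𝔸, ‖(n : ℝ)⁻¹ • Z‖ = (n : ℝ)⁻¹ * ‖Z‖ := fun Z => by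
      rw [norm_smul, Real.norm_of_nonneg (by positivity)]
    have ha : ‖a (n : ℝ)⁻¹‖ ≤ Real.exp ((n : ℝ)⁻¹ * c) := by
      refine (norm_mul_le _ _).trans ?_
      rw [mul_add, Real.exp_add, ← hsm, ← hsm]
      gcongr <;> exact NormedSpace.norm_exp_le_exp_norm _
    have hb : ‖b (n : ℝ)⁻¹‖ ≤ Real.exp ((n : ℝ)⁻¹ * c) := by
      refine (NormedSpace.norm_exp_le_exp_norm _).trans ?_
      rw [hsm]
      gcongr
      exact norm_add_le _ _
    refine (norm_pow_sub_pow_le_of_norm_le (Real.exp_nonneg _) ha hb n).trans ?_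
    have hpow : Real.exp ((n : ℝ)⁻¹ * c) ^ (n - 1) ≤ Real.exp c := by
      rw [← Real.exp_nat_mul]
      gcongr
      have h1 : ((n - 1 : ℕ) : ℝ) ≤ n := by exact_mod_cast Nat.sub_le _ _
      have h2 : 0 ≤ (n : ℝ)⁻¹ * c := by positivity
      calc ((n - 1 : ℕ) : ℝ) * ((n : ℝ)⁻¹ * c) ≤ n * ((n : ℝ)⁻¹ * c) := by gcongr
        _ = c := by field_simp
    rw [div_inv_eq_mul]
    calc (n : ℝ) * Real.exp ((n : ℝ)⁻¹ * c) ^ (n - 1) * ‖a (n : ℝ)⁻¹ - b (n : ℝ)⁻¹‖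
        ≤ n * Real.exp c * ‖a (n : ℝ)⁻¹ - b (n : ℝ)⁻¹‖ := by gcongr
      _ = _ := by ring
  have hzero : Tendsto (fun n : ℕ => ‖a (n : ℝ)⁻¹ - b (n : ℝ)⁻¹‖ / (n : ℝ)⁻¹) atTop (𝓝 0) :=
    hlo'.norm_left.tendsto_div_nhds_zero
  have hdiff : Tendsto (fun n : ℕ => a (n : ℝ)⁻¹ ^ n - b (n : ℝ)⁻¹ ^ n) atTop (𝓝 0) := by
    refine squeeze_zero_norm' ?_ (by simpa only [mul_zero] using hzero.const_mul (Real.exp c))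
    filter_upwards [eventually_ne_atTop 0] with n hn using hbound n hn
  have := hdiff.add_const (NormedSpace.exp (X + Y))
  rw [zero_add] at this
  refine this.congr' ?_
  filter_upwards [eventually_ne_atTop 0] with n hn
  rw [hexp n hn, sub_add_cancel]

end Trotter

/-! ### Trace inequalities -/

namespace Matrix

open scoped Matrix Matrix.Norms.L2Operator

variable {n : Type*} [Fintype n]

/-- The Hilbert-Schmidt norm of a matrix. -/
def hsNorm (A : Matrix n n ℂ) : ℝ := √(∑ i, ∑ j, ‖A i j‖ ^ 2)

theorem hsNorm_nonneg (A : Matrix n n ℂ) : 0 ≤ hsNorm A := Real.sqrt_nonneg _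

theorem hsNorm_sq (A : Matrix n n ℂ) : hsNorm A ^ 2 = ∑ i, ∑ j, ‖A i j‖ ^ 2 :=
  Real.sq_sqrt (by positivity)

theorem trace_conjTranspose_mul_self_eq (A : Matrix n n ℂ) :
    trace (Aᴴ * A) = ((hsNorm A ^ 2 : ℝ) : ℂ) := by
  rw [hsNorm_sq, Finset.sum_comm]
  push_cast
  simp only [trace, diag, mul_apply, conjTranspose_apply]
  refine Finset.sum_congr rfl fun i _ => Finset.sum_congr rfl fun j _ => ?_
  exact Complex.conj_mul' _

theorem hsNorm_conjTranspose (A : Matrix n n ℂ) : hsNorm Aᴴ = hsNorm A := by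
  rw [hsNorm, hsNorm, Finset.sum_comm]
  simp

theorem norm_trace_mul_le (A B : Matrix n n ℂ) : ‖trace (A * B)‖ ≤ hsNorm A * hsNorm B := by
  have h := Real.sum_mul_le_sqrt_mul_sqrt (Finset.univ : Finset (n × n))
    (fun p => ‖A p.1 p.2‖) (fun p => ‖Bᴴ p.1 p.2‖)
  rw [← hsNorm_conjTranspose B]
  simp only [hsNorm, ← Fintype.sum_prod_type']
  refine le_trans ?_ h
  rw [Fintype.sum_prod_type]
  simp only [trace, diag, mul_apply, conjTranspose_apply, norm_star]
  exact (norm_sum_le _ _).trans (Finset.sum_le_sum fun i _ =>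
    (norm_sum_le _ _).trans (Finset.sum_le_sum fun j _ => (norm_mul_le _ _)))

variable [DecidableEq n]

theorem hsNorm_mul_le (A B : Matrix n n ℂ) : hsNorm (A * B) ≤ ‖A‖ * hsNorm B := by
  refine Real.sqrt_le_iff.mpr ⟨mul_nonneg (norm_nonneg _) (hsNorm_nonneg _), ?_⟩
  rw [mul_pow, hsNorm_sq, Finset.sum_comm, Finset.sum_comm (f := fun i j => ‖B i j‖ ^ 2),
    Finset.mul_sum]
  refine Finset.sum_le_sum fun j _ => ?_
  have h := l2_opNorm_mulVec A (WithLp.toLp 2 fun i => B i j)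
  have h2 := pow_le_pow_left₀ (norm_nonneg _) h 2
  rw [mul_pow, EuclideanSpace.norm_sq_eq, EuclideanSpace.norm_sq_eq] at h2
  simpa [mulVec, dotProduct, mul_apply] using h2

theorem trace_mul_pow_comm (A B : Matrix n n ℂ) (k : ℕ) :
    trace ((A * B) ^ k) = trace ((B * A) ^ k) := by
  rcases k with _ | k
  · simp
  · rw [pow_succ, ← mul_assoc, mul_pow_mul, mul_assoc, trace_mul_comm, mul_assoc, ← pow_succ]

theorem hsNorm_pow_sq {Q : Matrix n n ℂ} (hQ : Q.IsHermitian) (m : ℕ) :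
    ((hsNorm (Q ^ m) ^ 2 : ℝ) : ℂ) = trace (Q ^ (2 * m)) := by
  rw [← trace_conjTranspose_mul_self_eq, (hQ.pow m).eq, two_mul, pow_add]

/-- Two inequalities proved by a common induction: a version of Weyl's majorant inequality, that
the trace norm of a power of `B` is at most the trace of the corresponding power of `|B|`, and the
Lieb-Thirring type inequality for products of Hermitian matrices. Each step squares the matrix and
uses both inequalities for half the exponent. -/
theorem norm_trace_pow_two_pow_le (k : ℕ) :
    (∀ A B : Matrix n n ℂ,
      ‖trace (A * B ^ 2 ^ (k + 1))‖ ≤ ‖A‖ * (trace ((Bᴴ * B) ^ 2 ^ k)).re) ∧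
    (∀ P Q : Matrix n n ℂ, P.IsHermitian → Q.IsHermitian →
      ‖trace ((P * Q) ^ 2 ^ k)‖ ≤ ‖trace (P ^ 2 ^ k * Q ^ 2 ^ k)‖) := by
  induction k with
  | zero =>
    refine ⟨fun A B => ?_, fun P Q _ _ => by simp⟩
    simp only [zero_add, pow_one, pow_zero, pow_two]
    rw [trace_conjTranspose_mul_self_eq, Complex.ofReal_re, ← mul_assoc, pow_two, ← mul_assoc]
    exact (norm_trace_mul_le _ _).trans
      (mul_le_mul_of_nonneg_right (hsNorm_mul_le A B) (hsNorm_nonneg B))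
  | succ k ih =>
    obtain ⟨ihC, ihG⟩ := ih
    refine ⟨fun A B => ?_, fun P Q hP hQ => ?_⟩
    · have h1 := ihC A (B ^ 2)
      rw [← pow_mul, ← pow_succ'] at h1
      refine h1.trans (mul_le_mul_of_nonneg_left ?_ (norm_nonneg _))
      set P := B * Bᴴ
      set Q := Bᴴ * B
      have hP : P.IsHermitian := isHermitian_mul_conjTranspose_self B
      have hQ : Q.IsHermitian := isHermitian_conjTranspose_mul_self B
      have h2 : trace (((B ^ 2)ᴴ * B ^ 2) ^ 2 ^ k) = trace ((Q * P) ^ 2 ^ k) := by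
        rw [pow_two, conjTranspose_mul, mul_assoc, trace_mul_pow_comm]
        simp only [P, Q, mul_assoc]
      have hPQ : hsNorm (P ^ 2 ^ k) = hsNorm (Q ^ 2 ^ k) := by
        rw [← sq_eq_sq₀ (hsNorm_nonneg _) (hsNorm_nonneg _), ← Complex.ofReal_inj,
          hsNorm_pow_sq hP, hsNorm_pow_sq hQ, trace_mul_pow_comm]
      have h3 : (trace (Q ^ 2 ^ (k + 1))).re = hsNorm (Q ^ 2 ^ k) ^ 2 := by
        rw [pow_succ', ← hsNorm_pow_sq hQ, Complex.ofReal_re]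
      rw [h2, h3]
      calc (trace ((Q * P) ^ 2 ^ k)).re ≤ ‖trace ((Q * P) ^ 2 ^ k)‖ := Complex.re_le_norm _
        _ ≤ ‖trace (Q ^ 2 ^ k * P ^ 2 ^ k)‖ := ihG Q P hQ hP
        _ ≤ hsNorm (Q ^ 2 ^ k) * hsNorm (P ^ 2 ^ k) := norm_trace_mul_le _ _
        _ = hsNorm (Q ^ 2 ^ k) ^ 2 := by rw [hPQ, pow_two]
    · have h1 := ihC 1 (P * Q)
      rw [one_mul] at h1
      have hone : ‖(1 : Matrix n n ℂ)‖ ≤ 1 := by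
        rcases isEmpty_or_nonempty n with h | h
        · rw [Subsingleton.elim (1 : Matrix n n ℂ) 0, norm_zero]; exact zero_le_one
        · exact CStarRing.norm_one.le
      have h2 : trace (((P * Q)ᴴ * (P * Q)) ^ 2 ^ k) = trace ((P ^ 2 * Q ^ 2) ^ 2 ^ k) := by
        rw [conjTranspose_mul, hP.eq, hQ.eq, mul_assoc, trace_mul_pow_comm]
        simp only [pow_two, mul_assoc]
      have h3 := ihG (P ^ 2) (Q ^ 2) (hP.pow 2) (hQ.pow 2)
      rw [← pow_mul, ← pow_mul, ← pow_succ'] at h3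
      rw [h2] at h1
      have h4 := (Complex.re_le_norm _).trans h3
      calc _ ≤ _ := h1
        _ ≤ ‖(1 : Matrix n n ℂ)‖ * ‖trace (P ^ 2 ^ (k + 1) * Q ^ 2 ^ (k + 1))‖ := by gcongr
        _ ≤ 1 * ‖trace (P ^ 2 ^ (k + 1) * Q ^ 2 ^ (k + 1))‖ := by gcongr
        _ = _ := one_mul _

/-- If `Q` is an orthogonal projection commuting with the Hermitian matrix `H`, then `W` changes
the trace of `Q exp H` at most by the factor `‖W‖`. -/
theorem norm_trace_mul_exp_mul_le {Q H : Matrix n n ℂ} (hQ : IsStarProjection Q)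
    (hH : H.IsHermitian) (hQH : Commute Q H) (W : Matrix n n ℂ) :
    ‖trace (Q * NormedSpace.exp H * W)‖ ≤ ‖W‖ * (trace (Q * NormedSpace.exp H)).re := by
  set K := Q * NormedSpace.exp ((1 / 2 : ℝ) • H)
  have hh : (((1 / 2 : ℝ) • H) : Matrix n n ℂ).IsHermitian := by
    rw [IsHermitian, conjTranspose_smul, hH.eq, star_trivial]
  have hQe : Commute Q (NormedSpace.exp ((1 / 2 : ℝ) • H)) := (hQH.smul_right _).exp_right
  have hQs : Qᴴ = Q := hQ.isSelfAdjoint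
  have hKK : Q * NormedSpace.exp H = K * Kᴴ := by
    have h2 : NormedSpace.exp H =
        NormedSpace.exp ((1 / 2 : ℝ) • H) * NormedSpace.exp ((1 / 2 : ℝ) • H) := by
      rw [← Matrix.exp_add_of_commute _ _ (Commute.refl _), ← add_smul]; norm_num
    simp only [K, conjTranspose_mul, hh.exp.eq, hQs]
    rw [h2, ← hQe.eq, mul_assoc, ← mul_assoc (NormedSpace.exp _) Q, ← hQe.eq, mul_assoc,
      ← mul_assoc Q Q, hQ.isIdempotentElem.eq]
  have h1 : trace (K * Kᴴ) = ((hsNorm K ^ 2 : ℝ) : ℂ) := by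
    rw [trace_mul_comm, trace_conjTranspose_mul_self_eq]
  rw [hKK, h1, Complex.ofReal_re, mul_assoc, trace_mul_comm, mul_assoc]
  calc ‖trace (Kᴴ * (W * K))‖ ≤ hsNorm Kᴴ * hsNorm (W * K) := norm_trace_mul_le _ _
    _ ≤ hsNorm K * (‖W‖ * hsNorm K) := by
        rw [hsNorm_conjTranspose]
        exact mul_le_mul_of_nonneg_left (hsNorm_mul_le W K) (hsNorm_nonneg K)
    _ = ‖W‖ * hsNorm K ^ 2 := by ring

theorem re_trace_mul_exp_nonneg {Q H : Matrix n n ℂ} (hQ : IsStarProjection Q)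
    (hH : H.IsHermitian) (hQH : Commute Q H) : 0 ≤ (trace (Q * NormedSpace.exp H)).re := by
  rcases isEmpty_or_nonempty n with h | h
  · simp [trace]
  · have := norm_trace_mul_exp_mul_le hQ hH hQH 1
    rw [CStarRing.norm_one, one_mul] at this
    exact (norm_nonneg _).trans this

/-- The inequality `norm_trace_mul_exp_add_le` before the limit in the Lie product formula. -/
theorem norm_trace_mul_exp_mul_exp_pow_le {Q H E : Matrix n n ℂ} (hQ : IsStarProjection Q)
    (hH : H.IsHermitian) (hQH : Commute Q H) (hQE : Commute Q E) (A : Matrix n n ℂ) (k : ℕ) :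
    ‖trace (A * (Q * (NormedSpace.exp (((2 ^ (k + 1) : ℕ) : ℝ)⁻¹ • H) *
        NormedSpace.exp (((2 ^ (k + 1) : ℕ) : ℝ)⁻¹ • E)) ^ 2 ^ (k + 1)))‖ ≤
      ‖A‖ * (‖(NormedSpace.exp (((2 ^ k : ℕ) : ℝ)⁻¹ • (1 / 2 : ℝ) • E) *
        NormedSpace.exp (((2 ^ k : ℕ) : ℝ)⁻¹ • (1 / 2 : ℝ) • Eᴴ)) ^ 2 ^ k‖ *
          (trace (Q * NormedSpace.exp H)).re) := by
  have hs : ∀ Z : Matrix n n ℂ, ((2 ^ k : ℕ) : ℝ)⁻¹ • (1 / 2 : ℝ) • Z =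
      ((2 ^ (k + 1) : ℕ) : ℝ)⁻¹ • Z := fun Z => by
    rw [smul_smul]; congr 1; push_cast; rw [pow_succ]; field_simp
  rw [hs, hs]
  have hm : ((2 ^ (k + 1) : ℕ) : ℝ) ≠ 0 := by positivity
  set s : ℝ := ((2 ^ (k + 1) : ℕ) : ℝ)⁻¹ with hsdef
  set a := NormedSpace.exp (s • H)
  set e := NormedSpace.exp (s • E)
  have hQs : Qᴴ = Q := hQ.isSelfAdjoint
  have hsH : (s • H : Matrix n n ℂ).IsHermitian := by
    rw [IsHermitian, conjTranspose_smul, hH.eq, star_trivial]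
  have haH : aᴴ = a := hsH.exp.eq
  have heH : NormedSpace.exp (s • Eᴴ) = eᴴ := by
    rw [← Matrix.exp_conjTranspose, conjTranspose_smul, star_trivial]
  have hQa : Commute Q a := (hQH.smul_right _).exp_right
  have hQe : Commute Q e := (hQE.smul_right _).exp_right
  have hQpow : ∀ j : ℕ, Q ^ 2 ^ j = Q := fun j => hQ.isIdempotentElem.pow_eq (by positivity)
  have hpow : a ^ 2 ^ (k + 1) = NormedSpace.exp H := by
    rw [← Matrix.exp_nsmul, ← Nat.cast_smul_eq_nsmul ℝ, smul_smul, hsdef, mul_inv_cancel₀ hm,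
      one_smul]
  set B := Q * (a * e)
  have hB : B ^ 2 ^ (k + 1) = Q * (a * e) ^ 2 ^ (k + 1) := by
    rw [(hQa.mul_right hQe).mul_pow, hQpow]
  have hp : (Q * (a * a)) ^ 2 ^ k = Q * NormedSpace.exp H := by
    rw [(hQa.mul_right hQa).mul_pow, hQpow, ← pow_two, ← pow_mul, ← pow_succ', hpow]
  have hpH : (Q * (a * a)).IsHermitian := by
    rw [IsHermitian, conjTranspose_mul, conjTranspose_mul, haH, hQs, (hQa.mul_right hQa).eq]
  have hBB : trace ((Bᴴ * B) ^ 2 ^ k) = trace ((Q * (a * a) * (e * eᴴ)) ^ 2 ^ k) := by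
    have : Bᴴ * B = eᴴ * (Q * (a * a) * e) := by
      simp only [B, conjTranspose_mul, haH, hQs]
      calc eᴴ * a * Q * (Q * (a * e)) = eᴴ * (a * (Q * Q)) * (a * e) := by noncomm_ring
        _ = eᴴ * (Q * (a * a) * e) := by
          rw [hQ.isIdempotentElem.eq, ← hQa.eq]; noncomm_ring
    rw [this, trace_mul_pow_comm, mul_assoc (Q * (a * a))]
  rw [← hB, heH]
  refine ((norm_trace_pow_two_pow_le k).1 A B).trans ?_
  refine mul_le_mul_of_nonneg_left ?_ (norm_nonneg _)
  rw [hBB]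
  refine (Complex.re_le_norm _).trans ?_
  refine ((norm_trace_pow_two_pow_le k).2 _ _ hpH (isHermitian_mul_conjTranspose_self e)).trans ?_
  rw [hp]
  exact norm_trace_mul_exp_mul_le hQ hH hQH _

/-- The trace of `exp (H + E)` with `H` Hermitian is controlled by the trace of `exp H` and the norm
of the Hermitian part of `E` alone: the anti-Hermitian part of `E`, however large, costs
nothing. -/
theorem norm_trace_mul_exp_add_le {Q H E : Matrix n n ℂ} (hQ : IsStarProjection Q)
    (hH : H.IsHermitian) (hQH : Commute Q H) (hQE : Commute Q E) (A : Matrix n n ℂ) :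
    ‖trace (A * (Q * NormedSpace.exp (H + E)))‖ ≤
      ‖A‖ * (Real.exp ‖(1 / 2 : ℝ) • E + (1 / 2 : ℝ) • Eᴴ‖ *
        (trace (Q * NormedSpace.exp H)).re) := by
  rcases isEmpty_or_nonempty n with h | h
  · simp [trace]
  have hpow : Tendsto (fun k : ℕ => 2 ^ k) atTop (atTop : Filter ℕ) :=
    tendsto_pow_atTop_atTop_of_one_lt (by norm_num)
  have h1 := (tendsto_exp_smul_mul_exp_smul_pow H E).comp (hpow.comp (tendsto_add_atTop_nat 1))
  have h2 := (tendsto_exp_smul_mul_exp_smul_pow ((1 / 2 : ℝ) • E) ((1 / 2 : ℝ) • Eᴴ)).comp hpow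
  have hcont : Continuous fun Z : Matrix n n ℂ => ‖trace (A * (Q * Z))‖ := by
    refine continuous_norm.comp (Continuous.matrix_trace ?_)
    fun_prop
  have h3 := (hcont.tendsto _).comp h1
  have h4 := ((h2.norm.mul_const (trace (Q * NormedSpace.exp H)).re).const_mul ‖A‖)
  refine (le_of_tendsto_of_tendsto' h3 h4 fun k => ?_).trans ?_
  · exact norm_trace_mul_exp_mul_exp_pow_le hQ hH hQH hQE A k
  · gcongr
    · exact re_trace_mul_exp_nonneg hQ hH hQH
    · exact NormedSpace.norm_exp_le_exp_norm _

end Matrix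

/-! ### The canonical anticommutation relations -/

namespace Fermion

open scoped Matrix Matrix.Norms.L2Operator

variable {ι : Type*} [Fintype ι] [DecidableEq ι]

/-- The exchange sign: the factor that the Jordan-Wigner sign of the mode `i` acquires when the
mode `j` is filled or emptied. -/
def exchangeSign (j i : ι) : ℂ := if Fintype.equivFin ι j < Fintype.equivFin ι i then -1 else 1

theorem exchangeSign_self (i : ι) : exchangeSign i i = 1 := by simp [exchangeSign]

theorem exchangeSign_add_swap {i j : ι} (h : i ≠ j) : exchangeSign i j + exchangeSign j i = 0 := by
  have hne : Fintype.equivFin ι i ≠ Fintype.equivFin ι j := fun h' => h (Equiv.injective _ h')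
  rcases hne.lt_or_gt with h' | h'
  · simp [exchangeSign, h', h'.not_gt]
  · simp [exchangeSign, h', h'.not_gt]

theorem exchangeSign_mul_self (i j : ι) : exchangeSign i j * exchangeSign i j = 1 := by
  unfold exchangeSign; split_ifs <;> simp

theorem sign_mul_self (i : ι) (S : Finset ι) : sign i S * sign i S = 1 := by
  rw [sign, ← mul_pow]; simp

theorem star_sign (i : ι) (S : Finset ι) : star (sign i S) = sign i S := by simp [sign]

theorem sign_insert (i : ι) {j : ι} {S : Finset ι} (h : j ∉ S) :
    sign i (insert j S) = exchangeSign j i * sign i S := by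
  unfold sign exchangeSign
  rw [Finset.filter_insert]
  split_ifs with h'
  · rw [Finset.card_insert_of_notMem (by simp [h]), pow_succ']
  · rw [one_mul]

theorem sign_erase (i : ι) {j : ι} {S : Finset ι} (h : j ∈ S) :
    sign i (S.erase j) = exchangeSign j i * sign i S := by
  conv_rhs => rw [← Finset.insert_erase h]
  rw [sign_insert i (Finset.notMem_erase j S), ← mul_assoc, exchangeSign_mul_self, one_mul]

theorem cre_apply (i : ι) (S' S : Finset ι) :
    cre i S' S = if i ∉ S ∧ S' = insert i S then sign i S else 0 := by
  rw [cre, Matrix.conjTranspose_apply, ann]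
  by_cases h : i ∉ S ∧ S' = insert i S
  · obtain ⟨h1, rfl⟩ := h
    rw [if_pos ⟨Finset.mem_insert_self _ _, (Finset.erase_insert h1).symm⟩, if_pos ⟨h1, rfl⟩,
      star_sign, sign_insert i h1, exchangeSign_self, one_mul]
  · rw [if_neg h, if_neg, star_zero]
    rintro ⟨h1, rfl⟩
    exact h ⟨Finset.notMem_erase _ _, (Finset.insert_erase h1).symm⟩

theorem mul_ann_apply (A : Op ι) (j : ι) (S' S : Finset ι) :
    (A * ann j) S' S = if j ∈ S then A S' (S.erase j) * sign j S else 0 := by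
  rw [Matrix.mul_apply]
  by_cases h : j ∈ S <;> simp [ann, h]

theorem mul_cre_apply (A : Op ι) (j : ι) (S' S : Finset ι) :
    (A * cre j) S' S = if j ∉ S then A S' (insert j S) * sign j S else 0 := by
  rw [Matrix.mul_apply]
  by_cases h : j ∈ S <;> simp [cre_apply, h]

theorem ann_mul_ann_add (i j : ι) : ann i * ann j + ann j * ann i = 0 := by
  ext S' S
  rw [Matrix.add_apply, mul_ann_apply, mul_ann_apply, Matrix.zero_apply]
  rcases eq_or_ne i j with rfl | hij
  · simp [ann]
  by_cases hi : i ∈ S <;> by_cases hj : j ∈ S <;> simp [ann, hi, hj, hij, hij.symm]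
  rw [Finset.erase_right_comm (a := j), sign_erase i hj, sign_erase j hi]
  split_ifs
  · linear_combination sign i S * sign j S * exchangeSign_add_swap hij
  · simp

theorem cre_mul_cre_add (i j : ι) : cre i * cre j + cre j * cre i = 0 := by
  have := congrArg Matrix.conjTranspose (ann_mul_ann_add j i)
  rwa [Matrix.conjTranspose_add, Matrix.conjTranspose_mul, Matrix.conjTranspose_mul,
    Matrix.conjTranspose_zero] at this

theorem ann_mul_cre_add (i j : ι) : ann i * cre j + cre j * ann i = if i = j then 1 else 0 := by
  ext S' S
  rw [Matrix.add_apply, mul_ann_apply, mul_cre_apply]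
  rcases eq_or_ne i j with rfl | hij
  · rw [if_pos rfl, Matrix.one_apply]
    by_cases hi : i ∈ S
    · simp [cre_apply, hi, sign_erase i hi, exchangeSign_self, sign_mul_self]
    · simp [ann, hi, sign_insert i hi, exchangeSign_self, sign_mul_self]
  · rw [if_neg hij, Matrix.zero_apply]
    by_cases hi : i ∈ S <;> by_cases hj : j ∈ S <;> simp [ann, cre_apply, hi, hj, hij, hij.symm]
    rw [Finset.erase_insert_of_ne hij.symm, sign_insert i hj, sign_erase j hi]
    split_ifs
    · linear_combination sign i S * sign j S * exchangeSign_add_swap hij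
    · simp

theorem ann_mul_self (i : ι) : ann i * ann i = 0 := by
  have h := ann_mul_ann_add i i
  rwa [← two_smul ℂ, smul_eq_zero_iff_right two_ne_zero] at h

theorem cre_mul_self (i : ι) : cre i * cre i = 0 := by
  have h := cre_mul_cre_add i i
  rwa [← two_smul ℂ, smul_eq_zero_iff_right two_ne_zero] at h

theorem conjTranspose_ann (i : ι) : (ann i)ᴴ = cre i := rfl

theorem conjTranspose_cre (i : ι) : (cre i)ᴴ = ann i := Matrix.conjTranspose_conjTranspose _

theorem norm_ann_le (i : ι) : ‖ann i‖ ≤ 1 := by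
  have hproj : IsStarProjection (cre i * ann i) := by
    constructor
    · have h := ann_mul_cre_add i i
      rw [if_pos rfl] at h
      have h' : ann i * cre i = 1 - cre i * ann i := eq_sub_of_add_eq h
      calc cre i * ann i * (cre i * ann i) = cre i * (ann i * cre i) * ann i := by noncomm_ring
        _ = cre i * ann i - cre i * cre i * (ann i * ann i) := by rw [h']; noncomm_ring
        _ = cre i * ann i := by rw [ann_mul_self, mul_zero, sub_zero]
    · exact Matrix.isHermitian_conjTranspose_mul_self (ann i)
  have h1 : ‖ann i‖ * ‖ann i‖ ≤ 1 := by
    rw [← CStarRing.norm_star_mul_self]; exact hproj.norm_le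
  nlinarith [norm_nonneg (ann i)]

theorem norm_cre_le (i : ι) : ‖cre i‖ ≤ 1 := by
  rw [cre, Matrix.l2_opNorm_conjTranspose]; exact norm_ann_le i

/-- The commutator of two quadratic operators is quadratic. -/
theorem cre_ann_commutator (i j k l : ι) :
    cre i * ann j * (cre k * ann l) - cre k * ann l * (cre i * ann j) =
      (if j = k then cre i * ann l else 0) - (if l = i then cre k * ann j else 0) := by
  have h1 : ann j * cre k = (if j = k then 1 else 0) - cre k * ann j :=
    eq_sub_of_add_eq (ann_mul_cre_add j k)
  have h2 : ann l * cre i = (if l = i then 1 else 0) - cre i * ann l :=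
    eq_sub_of_add_eq (ann_mul_cre_add l i)
  have h3 : ann j * ann l = -(ann l * ann j) := eq_neg_of_add_eq_zero_left (ann_mul_ann_add j l)
  have h4 : cre i * cre k = -(cre k * cre i) := eq_neg_of_add_eq_zero_left (cre_mul_cre_add i k)
  calc cre i * ann j * (cre k * ann l) - cre k * ann l * (cre i * ann j)
      = cre i * (ann j * cre k) * ann l - cre k * (ann l * cre i) * ann j := by noncomm_ring
    _ = cre i * (if j = k then 1 else 0) * ann l - cre k * (if l = i then 1 else 0) * ann j
        - (cre i * cre k * (ann j * ann l) - cre k * cre i * (ann l * ann j)) := by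
        rw [h1, h2]; noncomm_ring
    _ = _ := by
        rw [h3, h4, neg_mul_neg, sub_self, sub_zero]
        split_ifs <;> simp

/-! ### Operators of definite charge and gauge transformations -/

/-- `A` changes the charge `∑ i ∈ S, θ i` of the state `|S⟩` by exactly `q`. -/
def HasCharge (θ : ι → ℝ) (q : ℝ) (A : Op ι) : Prop :=
  ∀ S' S, A S' S ≠ 0 → ∑ i ∈ S', θ i = ∑ i ∈ S, θ i + q

section Charge

variable {θ : ι → ℝ} {q q' : ℝ} {A B : Op ι}

theorem hasCharge_ann (θ : ι → ℝ) (i : ι) : HasCharge θ (-θ i) (ann i) := by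
  intro S' S h
  obtain ⟨h1, rfl⟩ : i ∈ S ∧ S' = S.erase i := by
    by_contra h'; exact h (if_neg h')
  rw [← Finset.add_sum_erase S θ h1]; ring

theorem HasCharge.conjTranspose (hA : HasCharge θ q A) : HasCharge θ (-q) Aᴴ := by
  intro S' S h
  have := hA S S' (by simpa using h)
  linarith

theorem hasCharge_cre (θ : ι → ℝ) (i : ι) : HasCharge θ (θ i) (cre i) := by
  have h := (hasCharge_ann θ i).conjTranspose
  rwa [neg_neg] at h

theorem HasCharge.mul (hA : HasCharge θ q A) (hB : HasCharge θ q' B) :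
    HasCharge θ (q + q') (A * B) := by
  intro S' S h
  rw [Matrix.mul_apply] at h
  obtain ⟨R, -, hR⟩ := Finset.exists_ne_zero_of_sum_ne_zero h
  rw [hA S' R (left_ne_zero_of_mul hR), hB R S (right_ne_zero_of_mul hR)]
  ring

theorem HasCharge.add (hA : HasCharge θ q A) (hB : HasCharge θ q B) : HasCharge θ q (A + B) := by
  intro S' S h
  by_cases hA' : A S' S = 0
  · exact hB S' S fun hB' => h (by simp [hA', hB'])
  · exact hA S' S hA'

theorem HasCharge.smul (hA : HasCharge θ q A) (c : ℂ) : HasCharge θ q (c • A) := fun S' S h =>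
  hA S' S fun h' => h (by simp [h'])

theorem HasCharge.sum {κ : Type*} (s : Finset κ) {f : κ → Op ι}
    (hf : ∀ k ∈ s, HasCharge θ q (f k)) : HasCharge θ q (∑ k ∈ s, f k) := by
  intro S' S h
  rw [Matrix.sum_apply] at h
  obtain ⟨k, hk, hk'⟩ := Finset.exists_ne_zero_of_sum_ne_zero h
  exact hf k hk S' S hk'

theorem HasCharge.neg_left (hA : HasCharge θ q A) : HasCharge (-θ) (-q) A := by
  intro S' S h
  simp only [Pi.neg_apply, Finset.sum_neg_distrib, hA S' S h]
  ring

end Charge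

/-- The complex gauge transformation `exp (∑ i, θ i n_i)`, a positive operator. -/
def gauge (θ : ι → ℝ) : Op ι := Matrix.diagonal fun S => ((Real.exp (∑ i ∈ S, θ i) : ℝ) : ℂ)

theorem gauge_mul_gauge_neg (θ : ι → ℝ) : gauge θ * gauge (-θ) = 1 := by
  rw [gauge, gauge, Matrix.diagonal_mul_diagonal, ← Matrix.diagonal_one]
  congr 1; funext S
  rw [← Complex.ofReal_mul, ← Real.exp_add]
  simp

theorem gauge_neg_mul_gauge (θ : ι → ℝ) : gauge (-θ) * gauge θ = 1 := by
  simpa using gauge_mul_gauge_neg (-θ)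

/-- The gauge transformation as an invertible operator. -/
def gaugeUnit (θ : ι → ℝ) : (Op ι)ˣ :=
  ⟨gauge θ, gauge (-θ), gauge_mul_gauge_neg θ, gauge_neg_mul_gauge θ⟩

theorem HasCharge.gauge_conj {θ : ι → ℝ} {q : ℝ} {A : Op ι} (hA : HasCharge θ q A) :
    gauge θ * A * gauge (-θ) = ((Real.exp q : ℝ) : ℂ) • A := by
  ext S' S
  rw [gauge, gauge, Matrix.mul_diagonal, Matrix.diagonal_mul, Matrix.smul_apply, smul_eq_mul]
  by_cases h : A S' S = 0
  · simp [h]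
  rw [mul_right_comm, ← Complex.ofReal_mul, ← Real.exp_add, hA S' S h]
  congr 3
  simp only [Pi.neg_apply, Finset.sum_neg_distrib]; ring

/-- The projection to the states with `N` particles. -/
def sectorProj (N : ℕ) : Op ι := Matrix.diagonal fun S => if S.card = N then 1 else 0

theorem sectorTrace_eq_trace (N : ℕ) (A : Op ι) :
    sectorTrace N A = Matrix.trace (sectorProj N * A) := by
  rw [sectorTrace, Finset.sum_filter]
  simp [Matrix.trace, sectorProj]

theorem isStarProjection_sectorProj (N : ℕ) : IsStarProjection (sectorProj N : Op ι) := by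
  constructor
  · rw [IsIdempotentElem, sectorProj, Matrix.diagonal_mul_diagonal]
    congr 1; funext S; split_ifs <;> simp
  · rw [IsSelfAdjoint, Matrix.star_eq_conjTranspose, sectorProj, Matrix.diagonal_conjTranspose]
    congr 1; funext S
    by_cases h : S.card = N <;> simp [h]

/-- Operators of vanishing charge for `θ = 1` conserve the number of particles. -/
theorem HasCharge.commute_sectorProj {A : Op ι} (hA : HasCharge (fun _ => 1) 0 A) (N : ℕ) :
    Commute (sectorProj N) A := by
  ext S' S
  rw [sectorProj, Matrix.diagonal_mul, Matrix.mul_diagonal]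
  by_cases h : A S' S = 0
  · simp [h]
  have : S'.card = S.card := by
    have := hA S' S h
    simpa using this
  rw [this, mul_comm]

theorem commute_sectorProj_gauge (N : ℕ) (θ : ι → ℝ) :
    Commute (sectorProj N : Op ι) (gauge θ) := by
  rw [Commute, SemiconjBy, sectorProj, gauge, Matrix.diagonal_mul_diagonal,
    Matrix.diagonal_mul_diagonal]
  simp only [mul_comm]

theorem sectorTrace_mul_comm {A : Op ι} (hA : HasCharge (fun _ => 1) 0 A) (N : ℕ) (B : Op ι) :
    sectorTrace N (A * B) = sectorTrace N (B * A) := by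
  rw [sectorTrace_eq_trace, sectorTrace_eq_trace, ← mul_assoc, (hA.commute_sectorProj N).eq,
    mul_assoc, Matrix.trace_mul_comm, mul_assoc]

theorem sectorTrace_gauge_conj (N : ℕ) (θ : ι → ℝ) (A : Op ι) :
    sectorTrace N (gauge θ * A * gauge (-θ)) = sectorTrace N A := by
  rw [sectorTrace_eq_trace, sectorTrace_eq_trace, ← mul_assoc, ← mul_assoc,
    (commute_sectorProj_gauge N θ).eq, Matrix.trace_mul_comm, ← mul_assoc, ← mul_assoc,
    gauge_neg_mul_gauge, one_mul]

theorem sectorTrace_add (N : ℕ) (A B : Op ι) :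
    sectorTrace N (A + B) = sectorTrace N A + sectorTrace N B := by
  simp [sectorTrace, Finset.sum_add_distrib]

theorem sectorTrace_smul (N : ℕ) (c : ℂ) (A : Op ι) :
    sectorTrace N (c • A) = c * sectorTrace N A := by
  simp [sectorTrace, Finset.mul_sum]

/-! ### Quadratic operators and the bound by complex gauge transformations -/

/-- The operator `∑ i j, τ i j c†_i c_j`. -/
def hopping (τ : ι → ι → ℝ) : Op ι := ∑ i, ∑ j, (τ i j : ℂ) • (cre i * ann j)

theorem conjTranspose_hopping (τ : ι → ι → ℝ) : (hopping τ)ᴴ = hopping fun i j => τ j i := by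
  simp only [hopping, Matrix.conjTranspose_sum, Matrix.conjTranspose_smul,
    Matrix.conjTranspose_mul, conjTranspose_ann, conjTranspose_cre]
  rw [Finset.sum_comm]
  simp

theorem hopping_add (τ τ' : ι → ι → ℝ) :
    hopping τ + hopping τ' = hopping fun i j => τ i j + τ' i j := by
  simp [hopping, Finset.sum_add_distrib, add_smul]

theorem smul_hopping (c : ℝ) (τ : ι → ι → ℝ) :
    c • hopping τ = hopping fun i j => c * τ i j := by
  simp only [hopping, Finset.smul_sum, Complex.ofReal_mul, mul_smul, Complex.coe_smul]

theorem norm_hopping_le (τ : ι → ι → ℝ) : ‖hopping τ‖ ≤ ∑ i, ∑ j, |τ i j| := by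
  refine (norm_sum_le _ _).trans (Finset.sum_le_sum fun i _ =>
    (norm_sum_le _ _).trans (Finset.sum_le_sum fun j _ => ?_))
  rw [norm_smul, Complex.norm_real, Real.norm_eq_abs]
  have : ‖cre i * ann j‖ ≤ 1 := (norm_mul_le _ _).trans
    (mul_le_one₀ (norm_cre_le i) (norm_nonneg _) (norm_ann_le j))
  exact mul_le_of_le_one_right (abs_nonneg _) this

theorem hasCharge_hopping (τ : ι → ι → ℝ) : HasCharge (fun _ => 1) 0 (hopping τ) :=
  .sum _ fun i _ => .sum _ fun j _ => .smul
    (by simpa using (hasCharge_cre (fun _ => 1) i).mul (hasCharge_ann (fun _ => 1) j)) _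

theorem gauge_conj_hopping (θ : ι → ℝ) (τ : ι → ι → ℝ) :
    gauge θ * hopping τ * gauge (-θ) = hopping fun i j => τ i j * Real.exp (θ i - θ j) := by
  simp only [hopping, Finset.mul_sum, Finset.sum_mul]
  refine Finset.sum_congr rfl fun i _ => Finset.sum_congr rfl fun j _ => ?_
  rw [mul_smul_comm, smul_mul_assoc, ((hasCharge_cre θ i).mul (hasCharge_ann θ j)).gauge_conj,
    smul_smul, ← Complex.ofReal_mul, sub_eq_add_neg]

/-- The gauge transformation multiplies `A` by `exp q` and turns `τ i j` into
`τ i j * exp (θ i - θ j)`. Only the Hermitian part of the change, in which the exponential is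
replaced with the hyperbolic cosine, enters the bound. -/
theorem norm_sectorTrace_mul_exp_le {τ : ι → ι → ℝ} (hτ : ∀ i j, τ i j = τ j i) {W : Op ι}
    (hW : W.IsHermitian) (hWN : HasCharge (fun _ => 1) 0 W) {θ : ι → ℝ} (hWθ : HasCharge θ 0 W)
    {A : Op ι} {q : ℝ} (hA : HasCharge θ q A) (N : ℕ) :
    ‖sectorTrace N (A * NormedSpace.exp (hopping τ + W))‖ ≤
      ‖A‖ * Real.exp (q + ∑ i, ∑ j, |τ i j| * (Real.cosh (θ i - θ j) - 1)) *
        (sectorTrace N (NormedSpace.exp (hopping τ + W))).re := by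
  set H := hopping τ + W
  set E := hopping fun i j => τ i j * (Real.exp (θ i - θ j) - 1)
  have hH : H.IsHermitian := by
    have hτ' : (fun i j => τ j i) = τ := by funext i j; exact hτ j i
    rw [Matrix.IsHermitian, Matrix.conjTranspose_add, hW.eq, conjTranspose_hopping, hτ']
  have hHN : HasCharge (fun _ => 1) 0 H := (hasCharge_hopping τ).add hWN
  have hconj : gauge θ * NormedSpace.exp H * gauge (-θ) = NormedSpace.exp (H + E) := by
    have h1 := Matrix.exp_units_conj (gaugeUnit θ) H
    have h2 : gauge θ * H * gauge (-θ) = H + E := by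
      rw [mul_add, add_mul, gauge_conj_hopping, hWθ.gauge_conj, Real.exp_zero, Complex.ofReal_one,
        one_smul]
      simp only [H, E]
      rw [add_right_comm, hopping_add]
      congr 2
      funext i j
      ring
    rw [← h2]
    exact h1.symm
  have htrace : sectorTrace N (A * NormedSpace.exp H) =
      ((Real.exp q : ℝ) : ℂ) * Matrix.trace (A * (sectorProj N * NormedSpace.exp (H + E))) := by
    have hcomm : Commute (sectorProj N) (NormedSpace.exp (H + E)) :=
      (((hHN.add (hasCharge_hopping _)).commute_sectorProj N)).exp_right
    rw [← sectorTrace_gauge_conj N θ]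
    have : gauge θ * (A * NormedSpace.exp H) * gauge (-θ) =
        ((Real.exp q : ℝ) : ℂ) • (A * NormedSpace.exp (H + E)) := by
      rw [← smul_mul_assoc, ← hA.gauge_conj, ← hconj]
      calc _ = gauge θ * A * 1 * NormedSpace.exp H * gauge (-θ) := by noncomm_ring
        _ = _ := by rw [← gauge_neg_mul_gauge θ]; noncomm_ring
    rw [this, sectorTrace_smul, sectorTrace_eq_trace, hcomm.eq, Matrix.trace_mul_comm, mul_assoc]
  have hE : ‖(1 / 2 : ℝ) • E + (1 / 2 : ℝ) • Eᴴ‖ ≤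
      ∑ i, ∑ j, |τ i j| * (Real.cosh (θ i - θ j) - 1) := by
    have : (1 / 2 : ℝ) • E + (1 / 2 : ℝ) • Eᴴ =
        hopping fun i j => τ i j * (Real.cosh (θ i - θ j) - 1) := by
      rw [conjTranspose_hopping, smul_hopping, smul_hopping, hopping_add]
      congr 1
      funext i j
      rw [hτ j i, Real.cosh_eq, neg_sub]
      ring
    rw [this]
    refine (norm_hopping_le _).trans (Finset.sum_le_sum fun i _ => Finset.sum_le_sum fun j _ => ?_)
    rw [abs_mul, abs_of_nonneg (sub_nonneg.mpr (Real.one_le_cosh _))]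
  have hQ := isStarProjection_sectorProj (ι := ι) N
  have hQH := hHN.commute_sectorProj N
  have hZ := Matrix.re_trace_mul_exp_nonneg hQ hH hQH
  have hmain := Matrix.norm_trace_mul_exp_add_le hQ hH hQH
    ((hasCharge_hopping _).commute_sectorProj N : Commute _ E) A
  rw [htrace, norm_mul, Complex.norm_real, Real.norm_of_nonneg (Real.exp_nonneg _),
    sectorTrace_eq_trace, Real.exp_add]
  calc Real.exp q * ‖Matrix.trace (A * (sectorProj N * NormedSpace.exp (H + E)))‖
      ≤ Real.exp q * (‖A‖ * (Real.exp (∑ i, ∑ j, |τ i j| * (Real.cosh (θ i - θ j) - 1)) *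
        (Matrix.trace (sectorProj N * NormedSpace.exp H)).re)) := by
        refine mul_le_mul_of_nonneg_left (hmain.trans ?_) (Real.exp_nonneg _)
        gcongr
    _ = _ := by ring

theorem norm_canonicalAverage_le {τ : ι → ι → ℝ} (hτ : ∀ i j, τ i j = τ j i) {W : Op ι}
    (hW : W.IsHermitian) (hWN : HasCharge (fun _ => 1) 0 W) {θ : ι → ℝ} (hWθ : HasCharge θ 0 W)
    {A : Op ι} {q : ℝ} (hA : HasCharge θ q A) (N : ℕ) {β : ℝ} (hβ : 0 ≤ β) :
    ‖canonicalAverage (hopping τ + W) N β A‖ ≤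
      ‖A‖ * Real.exp (q + β * ∑ i, ∑ j, |τ i j| * (Real.cosh (θ i - θ j) - 1)) := by
  have hH : -(β : ℂ) • (hopping τ + W) =
      (hopping fun i j => -β * τ i j) + (((-β : ℝ) : ℂ) • W) := by
    rw [smul_add, ← smul_hopping, ← Complex.coe_smul, Complex.ofReal_neg]
  have hW' : ((((-β : ℝ) : ℂ) • W)).IsHermitian := by
    rw [Matrix.IsHermitian, Matrix.conjTranspose_smul, hW.eq]
    simp
  have h := norm_sectorTrace_mul_exp_le (τ := fun i j => -β * τ i j)
    (fun i j => by rw [hτ]) hW' (hWN.smul _) (hWθ.smul _) hA N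
  have hsum : ∑ i, ∑ j, |-β * τ i j| * (Real.cosh (θ i - θ j) - 1) =
      β * ∑ i, ∑ j, |τ i j| * (Real.cosh (θ i - θ j) - 1) := by
    simp only [Finset.mul_sum, abs_mul, abs_neg, abs_of_nonneg hβ, mul_assoc]
  rw [canonicalAverage, hH, norm_div, ← hsum]
  exact div_le_of_le_mul₀ (norm_nonneg _) (by positivity)
    (h.trans (mul_le_mul_of_nonneg_left (Complex.re_le_norm _) (by positivity)))

/-- The Ward identity of an operator `K` that conserves the number of particles and commutes with
the Hamiltonian. -/
theorem canonicalAverage_commutator {H K : Op ι} (hK : HasCharge (fun _ => 1) 0 K)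
    (hKH : Commute K H) (N : ℕ) (β : ℝ) (B : Op ι) :
    canonicalAverage H N β (K * B) = canonicalAverage H N β (B * K) := by
  have hX : Commute K (NormedSpace.exp (-(β : ℂ) • H)) := (hKH.smul_right _).exp_right
  rw [canonicalAverage, canonicalAverage, mul_assoc, sectorTrace_mul_comm hK, mul_assoc, ← hX.eq,
    mul_assoc]

theorem canonicalAverage_add (H : Op ι) (N : ℕ) (β : ℝ) (A B : Op ι) :
    canonicalAverage H N β (A + B) = canonicalAverage H N β A + canonicalAverage H N β B := by
  rw [canonicalAverage, add_mul, sectorTrace_add, add_div]; rfl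

theorem canonicalAverage_smul (H : Op ι) (N : ℕ) (β : ℝ) (c : ℂ) (A : Op ι) :
    canonicalAverage H N β (c • A) = c * canonicalAverage H N β A := by
  rw [canonicalAverage, smul_mul_assoc, sectorTrace_smul, mul_div_assoc]; rfl

end Fermion

/-! ### Correlations of the Hubbard model in a finite volume -/

namespace Hubbard

open Fermion
open scoped Matrix Matrix.Norms.L2Operator

variable {Λ : Type*} [Fintype Λ] [DecidableEq Λ]

/-- The spin-independent hopping amplitudes between modes. -/
def modeHopping (t : Λ → Λ → ℝ) (i j : Λ × Fin 2) : ℝ := if i.2 = j.2 then t i.1 j.1 else 0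

/-- The on-site interaction, which has charge zero for all `θ`. -/
def interaction (U : Λ → ℝ) : Op (Λ × Fin 2) := ∑ x, (U x : ℂ) • (num x 0 * num x 1)

theorem hamiltonian_eq (t : Λ → Λ → ℝ) (U : Λ → ℝ) :
    hamiltonian t U = hopping (modeHopping t) + interaction U := by
  rw [hamiltonian, interaction, hopping]
  congr 1
  simp only [Fintype.sum_prod_type, Fin.sum_univ_two, modeHopping, Finset.sum_add_distrib]
  simp

theorem hasCharge_num (θ : Λ × Fin 2 → ℝ) (x : Λ) (σ : Fin 2) : HasCharge θ 0 (num x σ) := by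
  unfold num
  simpa using (hasCharge_cre θ (x, σ)).mul (hasCharge_ann θ (x, σ))

theorem hasCharge_interaction (θ : Λ × Fin 2 → ℝ) (U : Λ → ℝ) :
    HasCharge θ 0 (interaction U) :=
  .sum _ fun x _ => .smul (by simpa using (hasCharge_num θ x 0).mul (hasCharge_num θ x 1)) _

theorem conjTranspose_num (x : Λ) (σ : Fin 2) : (num x σ)ᴴ = num x σ :=
  Matrix.isHermitian_conjTranspose_mul_self (ann (x, σ))

theorem num_mul_num_comm (x : Λ) : num x 0 * num x 1 = num x 1 * num x 0 := by
  have h := cre_ann_commutator (x, (0 : Fin 2)) (x, 0) (x, 1) (x, 1)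
  unfold num
  simpa [sub_eq_zero] using h

theorem isHermitian_interaction (U : Λ → ℝ) : (interaction U).IsHermitian := by
  rw [Matrix.IsHermitian, interaction, Matrix.conjTranspose_sum]
  refine Finset.sum_congr rfl fun x _ => ?_
  rw [Matrix.conjTranspose_smul, Matrix.conjTranspose_mul, conjTranspose_num, conjTranspose_num,
    num_mul_num_comm]
  simp

/-- The bound by the gauge transformation for the charges `s σ * φ x`, with `s σ = ±1`: equal
signs for the two spins give the rotation of the phase, opposite signs the rotation of the
spins about the third axis. -/
theorem norm_canonicalAverage_hamiltonian_le {t : Λ → Λ → ℝ} (ht : ∀ x y, t x y = t y x)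
    (U : Λ → ℝ) (N : ℕ) {β : ℝ} (hβ : 0 ≤ β) (φ : Λ → ℝ) {s : Fin 2 → ℝ}
    (hs : ∀ σ, s σ = 1 ∨ s σ = -1) {A : Op (Λ × Fin 2)} {q : ℝ}
    (hA : HasCharge (fun i => s i.2 * φ i.1) q A) (hA1 : ‖A‖ ≤ 1) :
    ‖canonicalAverage (hamiltonian t U) N β A‖ ≤
      Real.exp (q + 2 * β * ∑ x, ∑ y, |t x y| * (Real.cosh (φ x - φ y) - 1)) := by
  have hsum : ∑ i, ∑ j, |modeHopping t i j| *
      (Real.cosh (s i.2 * φ i.1 - s j.2 * φ j.1) - 1) =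
      2 * ∑ x, ∑ y, |t x y| * (Real.cosh (φ x - φ y) - 1) := by
    have hcosh : ∀ σ x y, Real.cosh (s σ * φ x - s σ * φ y) = Real.cosh (φ x - φ y) := by
      intro σ x y
      rcases hs σ with h | h <;> rw [h]
      · simp
      · rw [← Real.cosh_neg]; congr 1; ring
    simp only [Fintype.sum_prod_type, Fin.sum_univ_two, modeHopping, Finset.sum_add_distrib]
    simp [hcosh]
    ring
  rw [hamiltonian_eq]
  have h := norm_canonicalAverage_le (τ := modeHopping t)
    (fun i j => by simp only [modeHopping, eq_comm, ht i.1 j.1]) (isHermitian_interaction U)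
    (hasCharge_interaction _ U) (hasCharge_interaction _ U) hA N hβ
  rw [hsum] at h
  refine h.trans ?_
  rw [mul_comm 2 β, mul_assoc]
  exact mul_le_of_le_one_left (Real.exp_nonneg _) hA1

theorem norm_mul_le_one {A B : Op (Λ × Fin 2)} (hA : ‖A‖ ≤ 1) (hB : ‖B‖ ≤ 1) : ‖A * B‖ ≤ 1 :=
  (norm_mul_le _ _).trans (mul_le_one₀ hA (norm_nonneg _) hB)

theorem norm_canonicalAverage_pairOp_le {t : Λ → Λ → ℝ} (ht : ∀ x y, t x y = t y x)
    (U : Λ → ℝ) (N : ℕ) {β : ℝ} (hβ : 0 ≤ β) (φ : Λ → ℝ) (x y : Λ) :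
    ‖canonicalAverage (hamiltonian t U) N β (pairOp x y)‖ ≤
      2 * Real.exp (2 * (φ x - φ y) +
        2 * β * ∑ x, ∑ y, |t x y| * (Real.cosh (φ x - φ y) - 1)) := by
  have hc : HasCharge (fun i : Λ × Fin 2 => (1 : ℝ) * φ i.1) (2 * (φ x - φ y)) (pairHop x y) := by
    have h := (((hasCharge_cre (fun i : Λ × Fin 2 => (1 : ℝ) * φ i.1) (x, 0)).mul
      (hasCharge_cre _ (x, 1))).mul (hasCharge_ann _ (y, 0))).mul (hasCharge_ann _ (y, 1))
    convert h using 1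
    · ring
    · rfl
  have hc' : HasCharge (fun i : Λ × Fin 2 => (-1 : ℝ) * φ i.1) (2 * (φ x - φ y))
      (pairHop x y)ᴴ := by
    convert hc.conjTranspose.neg_left using 1
    · funext i; simp
    · ring
  have hn : ‖pairHop x y‖ ≤ 1 :=
    norm_mul_le_one (norm_mul_le_one (norm_mul_le_one (norm_cre_le _) (norm_cre_le _))
      (norm_ann_le _)) (norm_ann_le _)
  have hn' : ‖(pairHop x y)ᴴ‖ ≤ 1 := by rwa [Matrix.l2_opNorm_conjTranspose]
  rw [pairOp, canonicalAverage_add, two_mul (Real.exp _)]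
  exact (norm_add_le _ _).trans (add_le_add
    (norm_canonicalAverage_hamiltonian_le ht U N hβ φ (s := fun _ => 1) (by simp) hc hn)
    (norm_canonicalAverage_hamiltonian_le ht U N hβ φ (s := fun _ => -1) (by simp) hc' hn'))

/-! ### The Ward identity of the spin rotations -/

/-- The operator `S^+_x` raising the spin at the site `x`. -/
def raise (x : Λ) : Op (Λ × Fin 2) := cre (x, 0) * ann (x, 1)

/-- The operator `S^-_x` lowering the spin at the site `x`. -/
def lower (x : Λ) : Op (Λ × Fin 2) := cre (x, 1) * ann (x, 0)

theorem spin_zero (x : Λ) : spin 0 x = (1 / 2 : ℂ) • (raise x + lower x) := by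
  simp [spin, pauli, raise, lower]

theorem spin_one (x : Λ) :
    spin 1 x = (1 / 2 : ℂ) • (-Complex.I • raise x + Complex.I • lower x) := by
  simp [spin, pauli, raise, lower]

theorem spin_two (x : Λ) : spin 2 x = (1 / 2 : ℂ) • (num x 0 - num x 1) := by
  simp [spin, pauli, num, sub_eq_add_neg]

theorem spinDot_eq (x y : Λ) :
    spinDot x y = (1 / 2 : ℂ) • (raise x * lower y) + (1 / 2 : ℂ) • (lower x * raise y) +
      spin 2 x * spin 2 y := by
  rw [spinDot, Fin.sum_univ_three, spin_zero, spin_zero, spin_one, spin_one]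
  congr 1
  simp only [smul_mul_assoc, mul_smul_comm, mul_add, add_mul, smul_add, smul_smul]
  have hI : Complex.I * Complex.I = -1 := Complex.I_mul_I
  match_scalars <;> first
    | linear_combination (1 / 4 : ℂ) * hI
    | linear_combination (-1 / 4 : ℂ) * hI

/-- The lowering operator of the total spin. -/
def totalLower : Op (Λ × Fin 2) := ∑ z : Λ, lower z

theorem totalLower_commutator (x y : Λ) (σ τ : Fin 2) :
    totalLower * (cre (x, σ) * ann (y, τ)) - cre (x, σ) * ann (y, τ) * totalLower =
      (if σ = 0 then cre (x, 1) * ann (y, τ) else 0) -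
        (if τ = 1 then cre (x, σ) * ann (y, 0) else 0) := by
  rw [totalLower, Finset.sum_mul, Finset.mul_sum, ← Finset.sum_sub_distrib]
  simp only [lower, cre_ann_commutator, Finset.sum_sub_distrib, Prod.mk.injEq]
  congr 1
  · by_cases h : σ = 0
    · simp [h]
    · simp [h, Ne.symm h]
  · by_cases h : τ = 1
    · simp [h]
    · simp [h]

theorem hasCharge_totalLower : HasCharge (fun _ => 1) 0 (totalLower : Op (Λ × Fin 2)) :=
  .sum _ fun z _ => by
    simpa [lower] using (hasCharge_cre (fun _ => 1) (z, 1)).mul (hasCharge_ann (fun _ => 1) (z, 0))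

theorem totalLower_commutator_num_zero (x : Λ) :
    totalLower * num x 0 - num x 0 * totalLower = lower x := by
  rw [num, totalLower_commutator]; simp [lower]

theorem totalLower_commutator_num_one (x : Λ) :
    totalLower * num x 1 - num x 1 * totalLower = -lower x := by
  rw [num, totalLower_commutator]; simp [lower]

theorem lower_mul_num_one (x : Λ) : lower x * num x 1 = 0 := by
  have h : ann (x, (0 : Fin 2)) * cre (x, 1) = -(cre (x, 1) * ann (x, 0)) := by
    have := ann_mul_cre_add (x, (0 : Fin 2)) (x, 1)
    rw [if_neg (by simp)] at this
    exact eq_neg_of_add_eq_zero_left this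
  calc lower x * num x 1 = cre (x, 1) * (ann (x, 0) * cre (x, 1)) * ann (x, 1) := by
        rw [lower, num]; noncomm_ring
    _ = -(cre (x, 1) * cre (x, 1) * (ann (x, 0) * ann (x, 1))) := by rw [h]; noncomm_ring
    _ = 0 := by rw [cre_mul_self, zero_mul, neg_zero]

theorem num_zero_mul_lower (x : Λ) : num x 0 * lower x = 0 := by
  have h : ann (x, (0 : Fin 2)) * cre (x, 1) = -(cre (x, 1) * ann (x, 0)) := by
    have := ann_mul_cre_add (x, (0 : Fin 2)) (x, 1)
    rw [if_neg (by simp)] at this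
    exact eq_neg_of_add_eq_zero_left this
  calc num x 0 * lower x = cre (x, 0) * (ann (x, 0) * cre (x, 1)) * ann (x, 0) := by
        rw [lower, num]; noncomm_ring
    _ = -(cre (x, 0) * cre (x, 1) * (ann (x, 0) * ann (x, 0))) := by rw [h]; noncomm_ring
    _ = 0 := by rw [ann_mul_self, mul_zero, neg_zero]

theorem commute_totalLower_hamiltonian (t : Λ → Λ → ℝ) (U : Λ → ℝ) :
    Commute totalLower (hamiltonian t U) := by
  refine .add_right (.sum_right _ _ _ fun x _ => .sum_right _ _ _ fun y _ => ?_)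
    (.sum_right _ _ _ fun x _ => .smul_right ?_ _)
  · rw [← Finset.smul_sum, Fin.sum_univ_two]
    refine .smul_right ?_ _
    have h0 := totalLower_commutator x y 0 0
    have h1 := totalLower_commutator x y 1 1
    rw [if_pos rfl, if_neg (by decide), sub_zero] at h0
    rw [if_neg (by decide), if_pos rfl, zero_sub] at h1
    rw [Commute, SemiconjBy, ← sub_eq_zero, mul_add, add_mul, add_sub_add_comm, h0, h1,
      add_neg_cancel]
  · rw [Commute, SemiconjBy, ← sub_eq_zero]
    calc totalLower * (num x 0 * num x 1) - num x 0 * num x 1 * totalLower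
        = (totalLower * num x 0 - num x 0 * totalLower) * num x 1 +
          num x 0 * (totalLower * num x 1 - num x 1 * totalLower) := by noncomm_ring
      _ = 0 := by
        rw [totalLower_commutator_num_zero, totalLower_commutator_num_one, mul_neg,
          lower_mul_num_one, num_zero_mul_lower, neg_zero, add_zero]

/-- Rotation invariance of the canonical state relates the correlation of the third components to
the transverse one. It follows from the commutator of the total lowering operator with
`S^+_x S^(3)_y`. -/
theorem canonicalAverage_spin_two_mul_spin_two (t : Λ → Λ → ℝ) (U : Λ → ℝ) (N : ℕ) (β : ℝ)
    (x y : Λ) :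
    canonicalAverage (hamiltonian t U) N β (spin 2 x * spin 2 y) =
      1 / 2 * canonicalAverage (hamiltonian t U) N β (raise x * lower y) := by
  have hr : totalLower * raise x - raise x * totalLower = (-2 : ℂ) • spin 2 x := by
    rw [raise, totalLower_commutator, spin_two, smul_smul]
    simp [num]
  have hs : totalLower * spin 2 y - spin 2 y * totalLower = lower y := by
    rw [spin_two, mul_smul_comm, smul_mul_assoc, ← smul_sub, mul_sub, sub_mul, sub_sub_sub_comm,
      totalLower_commutator_num_zero, totalLower_commutator_num_one, sub_neg_eq_add, ← two_smul ℂ,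
      smul_smul]
    norm_num
  have hcomm : totalLower * (raise x * spin 2 y) =
      raise x * spin 2 y * totalLower + ((-2 : ℂ) • (spin 2 x * spin 2 y) + raise x * lower y) := by
    rw [← hs, ← smul_mul_assoc, ← hr]; noncomm_ring
  have h := canonicalAverage_commutator hasCharge_totalLower
    (commute_totalLower_hamiltonian t U) N β (raise x * spin 2 y)
  rw [hcomm, canonicalAverage_add, canonicalAverage_add, canonicalAverage_smul] at h
  linear_combination (-1 / 2 : ℂ) * h

theorem norm_canonicalAverage_spinDot_le {t : Λ → Λ → ℝ} (ht : ∀ x y, t x y = t y x)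
    (U : Λ → ℝ) (N : ℕ) {β : ℝ} (hβ : 0 ≤ β) (φ : Λ → ℝ) (x y : Λ) :
    ‖canonicalAverage (hamiltonian t U) N β (spinDot x y)‖ ≤
      2 * Real.exp (2 * (φ x - φ y) +
        2 * β * ∑ x, ∑ y, |t x y| * (Real.cosh (φ x - φ y) - 1)) := by
  set s : Fin 2 → ℝ := ![1, -1]
  have hs : ∀ σ, s σ = 1 ∨ s σ = -1 := by
    intro σ; fin_cases σ <;> simp [s]
  have hc : HasCharge (fun i : Λ × Fin 2 => s i.2 * φ i.1) (2 * (φ x - φ y))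
      (raise x * lower y) := by
    have h := ((hasCharge_cre (fun i : Λ × Fin 2 => s i.2 * φ i.1) (x, 0)).mul
      (hasCharge_ann _ (x, 1))).mul ((hasCharge_cre _ (y, 1)).mul (hasCharge_ann _ (y, 0)))
    convert h using 1
    · simp only [s, Matrix.cons_val_zero, Matrix.cons_val_one]
      ring
    · rfl
  have hc' : HasCharge (fun i : Λ × Fin 2 => (-s) i.2 * φ i.1) (2 * (φ x - φ y))
      (lower x * raise y) := by
    have h := ((hasCharge_cre (fun i : Λ × Fin 2 => (-s) i.2 * φ i.1) (x, 1)).mul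
      (hasCharge_ann _ (x, 0))).mul ((hasCharge_cre _ (y, 0)).mul (hasCharge_ann _ (y, 1)))
    convert h using 1
    · simp only [s, Pi.neg_apply, Matrix.cons_val_zero, Matrix.cons_val_one]
      ring
    · rfl
  have hnr : ∀ z : Λ, ‖raise z‖ ≤ 1 := fun z => norm_mul_le_one (norm_cre_le _) (norm_ann_le _)
  have hnl : ∀ z : Λ, ‖lower z‖ ≤ 1 := fun z => norm_mul_le_one (norm_cre_le _) (norm_ann_le _)
  have h1 := norm_canonicalAverage_hamiltonian_le ht U N hβ φ hs hc
    (norm_mul_le_one (hnr x) (hnl y))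
  have h2 := norm_canonicalAverage_hamiltonian_le ht U N hβ φ (s := -s)
    (fun σ => by rcases hs σ with h | h <;> simp [h]) hc' (norm_mul_le_one (hnl x) (hnr y))
  rw [spinDot_eq, canonicalAverage_add, canonicalAverage_add, canonicalAverage_smul,
    canonicalAverage_smul, canonicalAverage_spin_two_mul_spin_two]
  set a := canonicalAverage (hamiltonian t U) N β (raise x * lower y)
  set b := canonicalAverage (hamiltonian t U) N β (lower x * raise y)
  have hab : 1 / 2 * a + 1 / 2 * b + 1 / 2 * a = a + 1 / 2 * b := by ring
  rw [hab]
  refine (norm_add_le _ _).trans ?_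
  rw [norm_mul]
  have : ‖(1 / 2 : ℂ)‖ = 1 / 2 := by norm_num
  rw [this]
  linarith [norm_nonneg b]

end Hubbard

/-! ### The decay rate as a function of the temperature -/

theorem Real.cosh_sub_one_le_sq_mul_cosh (z : ℝ) : Real.cosh z - 1 ≤ z ^ 2 * Real.cosh z := by
  wlog hz : 0 ≤ z generalizing z
  · have := this (-z) (by linarith)
    rwa [Real.cosh_neg, neg_sq] at this
  have h1 : Real.exp (z / 2) - Real.exp (-(z / 2)) ≤ z * Real.exp (z / 2) := by
    have h : 1 - Real.exp (-z) ≤ z := by linarith [Real.add_one_le_exp (-z)]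
    have h' : Real.exp (-(z / 2)) = Real.exp (z / 2) * Real.exp (-z) := by
      rw [← Real.exp_add]; congr 1; ring
    rw [h']
    nlinarith [Real.exp_pos (z / 2)]
  have h0 : 0 ≤ Real.exp (z / 2) - Real.exp (-(z / 2)) :=
    sub_nonneg.mpr (Real.exp_le_exp.mpr (by linarith))
  have h2 := pow_le_pow_left₀ h0 h1 2
  have e1 : Real.exp (z / 2) ^ 2 = Real.exp z := by
    rw [← Real.exp_nat_mul]; congr 1; push_cast; ring
  have e2 : Real.exp (-(z / 2)) ^ 2 = Real.exp (-z) := by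
    rw [← Real.exp_nat_mul]; congr 1; push_cast; ring
  have e3 : Real.exp (z / 2) * Real.exp (-(z / 2)) = 1 := by rw [← Real.exp_add]; simp
  rw [mul_pow, e1, sub_sq, e1, e2, mul_assoc, e3] at h2
  rw [Real.cosh_eq]
  nlinarith [mul_nonneg (sq_nonneg z) (Real.exp_nonneg (-z))]

theorem Real.log_mul_sqrt_le {w : ℝ} (hw : 1 ≤ w) : Real.log w * √w ≤ w - 1 := by
  have hw0 : 0 < w := by linarith
  have h := Real.self_le_sinh_iff.mpr (show 0 ≤ Real.log w / 2 by
    have := Real.log_nonneg hw; linarith)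
  rw [← Real.log_sqrt hw0.le, Real.sinh_eq, Real.exp_neg, Real.exp_log (Real.sqrt_pos.mpr hw0),
    Real.log_sqrt hw0.le] at h
  have hs := Real.mul_self_sqrt hw0.le
  have hsp := Real.sqrt_pos.mpr hw0
  have h2 := mul_le_mul_of_nonneg_right h hsp.le
  have h3 : (√w - (√w)⁻¹) / 2 * √w = (w - 1) / 2 := by
    field_simp
    linarith
  linarith

namespace Hubbard

/-- The decay rate at inverse temperature `β`, up to a constant factor. -/
def decayRate (β : ℝ) : ℝ := Real.log (1 + 1 / β)

theorem decayRate_pos {β : ℝ} (hβ : 0 < β) : 0 < decayRate β :=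
  Real.log_pos (by have : 0 < 1 / β := by positivity
                   linarith)

theorem strictAntiOn_decayRate : StrictAntiOn decayRate (Set.Ioi 0) := by
  intro a ha b _ hab
  have ha' : (0 : ℝ) < a := ha
  have hb' : 0 < b := ha'.trans hab
  refine Real.log_lt_log (by positivity) ?_
  gcongr

theorem decayRate_isEquivalent_atTop : decayRate ~[atTop] fun β => 1 / β := by
  refine (isEquivalent_iff_tendsto_one ?_).mpr ?_
  · filter_upwards [eventually_gt_atTop 0] with β hβ
    positivity
  · refine (Real.tendsto_mul_log_one_add_div_atTop 1).congr fun β => ?_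
    simp [decayRate, mul_comm]

/-- The constant `2 / δ` of the high-temperature behaviour is one, so that `δ = 2`. -/
theorem decayRate_isEquivalent_zero :
    decayRate ~[𝓝[>] 0] fun β => 2 / 2 * |Real.log β| := by
  have h1 : Tendsto (fun β => |Real.log β|) (𝓝[>] 0) atTop :=
    tendsto_abs_atBot_atTop.comp Real.tendsto_log_nhdsGT_zero
  have h2 : Tendsto (fun β : ℝ => Real.log (1 + β)) (𝓝[>] 0) (𝓝 0) := by
    have : ContinuousAt (fun β : ℝ => Real.log (1 + β)) 0 := by
      refine ContinuousAt.log (by fun_prop) (by norm_num)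
    have h := this.tendsto
    simp only [add_zero, Real.log_one] at h
    exact h.mono_left nhdsWithin_le_nhds
  have h3 : (fun β : ℝ => Real.log (1 + β)) =o[𝓝[>] 0] fun β => 2 / 2 * |Real.log β| := by
    have h4 : (fun β : ℝ => Real.log (1 + β)) =o[𝓝[>] 0] fun _ => (1 : ℝ) :=
      (isLittleO_one_iff ℝ).mpr h2
    refine h4.trans_isBigO ?_
    refine (IsBigO.of_bound 1 ?_)
    filter_upwards [h1.eventually_ge_atTop 1] with β hβ
    rw [div_self two_ne_zero, one_mul, one_mul, norm_one, Real.norm_eq_abs, abs_abs]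
    exact hβ
  refine h3.congr' ?_ EventuallyEq.rfl
  have hlt : ∀ᶠ β : ℝ in 𝓝[>] 0, β < 1 :=
    nhdsWithin_le_nhds (eventually_lt_nhds zero_lt_one)
  filter_upwards [self_mem_nhdsWithin, hlt] with β hβ hβ1
  have hβ' : (0 : ℝ) < β := hβ
  have : 1 + 1 / β = (1 + β) / β := by field_simp; ring
  rw [Pi.sub_apply, decayRate, this, Real.log_div (by positivity) hβ'.ne', div_self two_ne_zero,
    one_mul, abs_of_neg (Real.log_neg hβ' hβ1)]
  ring

/-- The rotation strength `κ = a * decayRate β` balances the gain, linear in `κ`, against the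
cost, of order `β κ² cosh (κ R)`, at all temperatures. -/
theorem mul_decayRate_mul_cosh_le {a R β : ℝ} (ha : 0 ≤ a) (hR : 0 ≤ R) (haR : a * R ≤ 1 / 2)
    (hβ : 0 < β) : β * (a * decayRate β) * Real.cosh (a * decayRate β * R) ≤ a := by
  have hf := decayRate_pos hβ
  set w := 1 + 1 / β with hw
  have hw1 : 1 ≤ w := by have : 0 < 1 / β := by positivity
                         linarith
  have hcosh : Real.cosh (a * decayRate β * R) ≤ √w := by
    have h1 : Real.cosh (a * decayRate β * R) ≤ Real.exp (a * decayRate β * R) := by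
      rw [Real.cosh_eq]
      have : Real.exp (-(a * decayRate β * R)) ≤ Real.exp (a * decayRate β * R) :=
        Real.exp_le_exp.mpr (by have : 0 ≤ a * decayRate β * R := by positivity
                                linarith)
      linarith
    have h2 : √w = Real.exp (decayRate β / 2) := by
      rw [decayRate, ← hw, ← Real.log_sqrt (by linarith), Real.exp_log]
      exact Real.sqrt_pos.mpr (by linarith)
    rw [h2]
    refine h1.trans (Real.exp_le_exp.mpr ?_)
    calc a * decayRate β * R = a * R * decayRate β := by ring
      _ ≤ 1 / 2 * decayRate β := by gcongr
      _ = decayRate β / 2 := by ring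
  calc β * (a * decayRate β) * Real.cosh (a * decayRate β * R)
      ≤ β * (a * decayRate β) * √w := by gcongr
    _ = a * β * (Real.log w * √w) := by rw [decayRate]; ring
    _ ≤ a * β * (w - 1) := by
        gcongr; exact Real.log_mul_sqrt_le hw1
    _ = a := by rw [hw]; field_simp; ring

/-! ### Rotation angles and the number of sites -/

variable {d : ℕ} {V : Type*}

open MeasureTheory in
/-- Counting sites by integrating the number of sites within distance one of a point. -/
theorem Model.exists_card_le (M : Model d V) : ∃ K : ℝ, 0 ≤ K ∧ ∀ (s : Finset V) (x : V) (ρ : ℝ),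
    0 ≤ ρ → (∀ v ∈ s, M.siteDist v x ≤ ρ) → (s.card : ℝ) ≤ K * (1 + ρ) ^ d := by
  obtain ⟨K, hK⟩ := M.bounded_density
  refine ⟨K, Nat.cast_nonneg K, fun s x ρ hρ hs => ?_⟩
  set c := volume (Metric.closedBall (0 : EuclideanSpace ℝ (Fin d)) 1) with hc
  have hc0 : c ≠ 0 := (Metric.measure_closedBall_pos volume _ one_pos).ne'
  have hct : c ≠ ⊤ := measure_closedBall_lt_top.ne
  have hball : ∀ v, volume (Metric.closedBall (M.pos v) 1) = c := fun v => by
    rw [Measure.addHaar_closedBall' _ _ zero_le_one]; simp [hc]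
  have hbig : volume (Metric.closedBall (M.pos x) (1 + ρ)) = ENNReal.ofReal ((1 + ρ) ^ d) * c := by
    rw [Measure.addHaar_closedBall' _ _ (by positivity), finrank_euclideanSpace_fin]
  have hle : (s.card : ENNReal) * c ≤ K * (ENNReal.ofReal ((1 + ρ) ^ d) * c) := by
    calc (s.card : ENNReal) * c = ∑ v ∈ s, volume (Metric.closedBall (M.pos v) 1) := by
          simp [hball]
      _ = ∫⁻ p, ∑ v ∈ s, (Metric.closedBall (M.pos v) 1).indicator (fun _ => (1 : ENNReal)) p := by
          rw [lintegral_finsetSum _ fun v _ => measurable_const.indicator measurableSet_closedBall]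
          simp [lintegral_indicator measurableSet_closedBall]
      _ ≤ ∫⁻ p, (Metric.closedBall (M.pos x) (1 + ρ)).indicator (fun _ => (K : ENNReal)) p := by
          refine lintegral_mono fun p => ?_
          by_cases hp : p ∈ Metric.closedBall (M.pos x) (1 + ρ)
          · rw [Set.indicator_of_mem hp]
            classical
            simp only [Set.indicator_apply, Finset.sum_ite, Finset.sum_const_zero, add_zero,
              Finset.sum_const, nsmul_eq_mul, mul_one]
            have hsub : ((s.filter fun v => p ∈ Metric.closedBall (M.pos v) 1 : Finset V) : Set V) ⊆
                {v | dist (M.pos v) p ≤ 1} := by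
              intro v hv
              have := (Finset.mem_filter.mp hv).2
              rwa [Metric.mem_closedBall, dist_comm] at this
            have := (Set.encard_le_encard hsub).trans (hK p)
            rw [Set.encard_coe_eq_coe_finsetCard] at this
            exact_mod_cast this
          · rw [Set.indicator_of_notMem hp, Finset.sum_eq_zero]
            intro v hv
            refine Set.indicator_of_notMem (fun hpv => hp ?_) _
            rw [Metric.mem_closedBall] at hpv ⊢
            exact (dist_triangle _ _ _).trans (add_le_add hpv (hs v hv))
      _ = K * (ENNReal.ofReal ((1 + ρ) ^ d) * c) := by
          rw [lintegral_indicator measurableSet_closedBall, lintegral_const,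
            Measure.restrict_apply_univ, hbig]
  rw [← mul_assoc, ENNReal.mul_le_mul_iff_left hc0 hct] at hle
  have h := ENNReal.toReal_mono (by finiteness) hle
  rw [ENNReal.toReal_mul, ENNReal.toReal_ofReal (by positivity)] at h
  simpa using h

theorem Model.siteDist_nonneg (M : Model d V) (x y : V) : 0 ≤ M.siteDist x y := dist_nonneg

theorem Model.siteDist_comm (M : Model d V) (x y : V) : M.siteDist x y = M.siteDist y x :=
  dist_comm _ _

theorem Model.siteDist_self (M : Model d V) (x : V) : M.siteDist x x = 0 := dist_self _

theorem Model.finite_siteDist_lt (M : Model d V) (x : V) (r : ℝ) :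
    {u | M.siteDist u x < r}.Finite := by
  obtain ⟨K, -, hK⟩ := M.exists_card_le
  by_contra hinf
  obtain ⟨m, hm⟩ := exists_nat_gt (K * (1 + max r 0) ^ d)
  obtain ⟨s, hs, hcard⟩ := Set.Infinite.exists_subset_card_eq hinf m
  have := hK s x (max r 0) (le_max_right _ _) fun v hv => (hs hv).le.trans (le_max_left _ _)
  rw [hcard] at this
  linarith

/-- The dependence `ψ` of the rotation angle on the distance from a site, with the bound `w` for
its slope. -/
structure RotationProfile where
  ψ : ℝ → ℝ
  w : ℝ → ℝ
  ψ_zero : ψ 0 = 0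
  mono : ∀ a b, 0 ≤ a → a ≤ b → ψ a ≤ ψ b
  slope : ∀ a b, 0 ≤ a → a ≤ b → ψ b - ψ a ≤ w a * (b - a)
  w_nonneg : ∀ a, 0 ≤ a → 0 ≤ w a
  w_le_one : ∀ a, 0 ≤ a → w a ≤ 1

/-- The energy density of the rotation at a site of distance `s`, for a rotation that ends at
distance `r`. -/
def RotationProfile.density (P : RotationProfile) (r s : ℝ) : ℝ := if s < r then P.w s ^ 2 else 0

theorem RotationProfile.density_nonneg (P : RotationProfile) (r s : ℝ) : 0 ≤ P.density r s := by
  unfold RotationProfile.density; split_ifs <;> positivity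

/-- The rotation angle at distance `s`: it vanishes beyond `r`, so that boundary conditions do not
matter. -/
def RotationProfile.angle (P : RotationProfile) (κ r s : ℝ) : ℝ := κ * (P.ψ (min s r) - P.ψ r)

theorem RotationProfile.cosh_angle_sub_le (P : RotationProfile) {κ r R s s' : ℝ} (hκ : 0 ≤ κ)
    (hs : 0 ≤ s) (hss' : s ≤ s') (hR : s' - s ≤ R) :
    Real.cosh (P.angle κ r s - P.angle κ r s') - 1 ≤
      κ ^ 2 * R ^ 2 * Real.cosh (κ * R) * P.density r s := by
  unfold RotationProfile.density
  split_ifs with hr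
  · have hle : s ≤ min s' r := le_min hss' hr.le
    have hR0 : 0 ≤ R := by linarith
    have hw := P.w_nonneg s hs
    have hw1 := P.w_le_one s hs
    set z := P.angle κ r s' - P.angle κ r s with hz
    have hzeq : z = κ * (P.ψ (min s' r) - P.ψ s) := by
      rw [hz, RotationProfile.angle, RotationProfile.angle, min_eq_left hr.le]; ring
    have hz0 : 0 ≤ z := by
      rw [hzeq]; exact mul_nonneg hκ (sub_nonneg.mpr (P.mono _ _ hs hle))
    have hz1 : z ≤ κ * R * P.w s := by
      rw [hzeq, mul_assoc]
      refine mul_le_mul_of_nonneg_left ((P.slope _ _ hs hle).trans ?_) hκ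
      rw [mul_comm R]
      refine mul_le_mul_of_nonneg_left ?_ hw
      linarith [min_le_left s' r]
    have hz2 : z ≤ κ * R := hz1.trans (mul_le_of_le_one_right (by positivity) hw1)
    have hc : Real.cosh z ≤ Real.cosh (κ * R) := by
      rw [Real.cosh_le_cosh, abs_of_nonneg hz0, abs_of_nonneg (by positivity)]
      exact hz2
    rw [← neg_sub (P.angle κ r s'), ← hz, Real.cosh_neg]
    calc Real.cosh z - 1 ≤ z ^ 2 * Real.cosh z := Real.cosh_sub_one_le_sq_mul_cosh z
      _ ≤ (κ * R * P.w s) ^ 2 * Real.cosh (κ * R) := by gcongr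
      _ = _ := by ring
  · have hr' : r ≤ s := not_lt.mp hr
    rw [RotationProfile.angle, RotationProfile.angle, min_eq_right hr',
      min_eq_right (hr'.trans hss')]
    simp

/-- The cost of a rotation around `x` in a finite set of sites. Only the amplitudes of bonds with a
site inside the ball of radius `r` matter. -/
theorem Model.sum_cosh_angle_le (M : Model d V) {R T κ r N : ℝ} (hκ : 0 ≤ κ)
    (hT : 0 ≤ T) (P : RotationProfile) (x : V) (Λ : Finset V) {t : V → V → ℝ}
    (ht : ∀ u v, t u v = t v u)
    (htRT : ∀ u ∈ Λ, ∀ v ∈ Λ, M.siteDist u x < r → u ≠ v →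
      |t u v| ≤ T ∧ (R < M.siteDist u v → t u v = 0))
    (hN : ∀ u ∈ Λ, ((Λ.filter fun v => M.siteDist v u ≤ R).card : ℝ) ≤ N) :
    ∑ u ∈ Λ, ∑ v ∈ Λ, |t u v| *
        (Real.cosh (P.angle κ r (M.siteDist u x) - P.angle κ r (M.siteDist v x)) - 1) ≤
      2 * T * N * (κ ^ 2 * R ^ 2 * Real.cosh (κ * R)) *
        ∑ u ∈ Λ, P.density r (M.siteDist u x) := by
  classical
  set D := κ ^ 2 * R ^ 2 * Real.cosh (κ * R) with hD
  have hD0 : 0 ≤ D := by have := Real.cosh_pos (κ * R); positivity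
  set g : V → ℝ := fun u => P.density r (M.siteDist u x) with hg
  have hg0 : ∀ u, 0 ≤ g u := fun u => P.density_nonneg _ _
  set C : V → V → ℝ := fun u v => |t u v| *
    (Real.cosh (P.angle κ r (M.siteDist u x) - P.angle κ r (M.siteDist v x)) - 1) with hC
  have hCsymm : ∀ u v, C u v = C v u := fun u v => by
    simp only [hC]; rw [ht u v, ← neg_sub (P.angle κ r (M.siteDist v x)), Real.cosh_neg]
  have key : ∀ u ∈ Λ, ∀ v ∈ Λ, M.siteDist u x ≤ M.siteDist v x →
      C u v ≤ if M.siteDist v u ≤ R then T * D * g u else 0 := by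
    intro u hu v hv huv
    rcases eq_or_ne u v with rfl | hne
    · simp only [hC, sub_self, Real.cosh_zero, mul_zero]
      split_ifs
      · have := hg0 u; positivity
      · exact le_rfl
    by_cases hur : M.siteDist u x < r
    · obtain ⟨h1, h2⟩ := htRT u hu v hv hur hne
      split_ifs with hR
      · have htri : M.siteDist v x - M.siteDist u x ≤ R := by
          have : M.siteDist v x ≤ M.siteDist v u + M.siteDist u x := dist_triangle _ _ _
          linarith
        have h3 := P.cosh_angle_sub_le (r := r) hκ (M.siteDist_nonneg u x) huv htri
        have h4 := sub_nonneg.mpr (Real.one_le_cosh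
          (P.angle κ r (M.siteDist u x) - P.angle κ r (M.siteDist v x)))
        calc C u v ≤ T * (D * g u) := mul_le_mul h1 h3 h4 hT
          _ = _ := by ring
      · rw [M.siteDist_comm] at hR
        simp [hC, h2 (not_le.mp hR)]
    · have hur' := not_lt.mp hur
      have h0 : C u v = 0 := by
        simp only [hC]
        rw [RotationProfile.angle, RotationProfile.angle, min_eq_right hur',
          min_eq_right (hur'.trans huv)]
        simp
      rw [h0]
      split_ifs
      · have := hg0 u; positivity
      · exact le_rfl
  have key2 : ∀ u ∈ Λ, ∀ v ∈ Λ, C u v ≤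
      (if M.siteDist v u ≤ R then T * D * g u else 0) +
        (if M.siteDist u v ≤ R then T * D * g v else 0) := by
    have hpos : ∀ u v, 0 ≤ if M.siteDist v u ≤ R then T * D * g u else 0 := fun u v => by
      split_ifs
      · have := hg0 u; positivity
      · exact le_rfl
    intro u hu v hv
    rcases le_total (M.siteDist u x) (M.siteDist v x) with h | h
    · exact (key u hu v hv h).trans (le_add_of_nonneg_right (hpos v u))
    · rw [hCsymm]
      exact (key v hv u hu h).trans (le_add_of_nonneg_left (hpos u v))
  have hsum : ∑ u ∈ Λ, ∑ v ∈ Λ, (if M.siteDist v u ≤ R then T * D * g u else 0) ≤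
      T * N * D * ∑ u ∈ Λ, g u := by
    rw [Finset.mul_sum]
    refine Finset.sum_le_sum fun u hu => ?_
    rw [← Finset.sum_filter, Finset.sum_const, nsmul_eq_mul]
    have := hg0 u
    calc _ ≤ N * (T * D * g u) := by gcongr; exact hN u hu
      _ = _ := by ring
  calc ∑ u ∈ Λ, ∑ v ∈ Λ, C u v ≤ ∑ u ∈ Λ, ∑ v ∈ Λ,
        ((if M.siteDist v u ≤ R then T * D * g u else 0) +
          (if M.siteDist u v ≤ R then T * D * g v else 0)) :=
        Finset.sum_le_sum fun u hu => Finset.sum_le_sum fun v hv => key2 u hu v hv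
    _ = 2 * ∑ u ∈ Λ, ∑ v ∈ Λ, (if M.siteDist v u ≤ R then T * D * g u else 0) := by
        simp only [Finset.sum_add_distrib]
        rw [Finset.sum_comm (f := fun u v => if M.siteDist u v ≤ R then T * D * g v else 0)]
        ring
    _ ≤ 2 * (T * N * D * ∑ u ∈ Λ, g u) := by gcongr
    _ = _ := by ring

/-- The linear rotation used in one dimension. -/
def RotationProfile.linear : RotationProfile where
  ψ s := s
  w _ := 1
  ψ_zero := rfl
  mono _ _ _ h := h
  slope a b _ _ := by linarith
  w_nonneg _ _ := zero_le_one
  w_le_one _ _ := le_rfl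

/-- The logarithmic rotation used in two dimensions. -/
def RotationProfile.logarithmic : RotationProfile where
  ψ s := Real.log (1 + s)
  w s := (1 + s)⁻¹
  ψ_zero := by simp
  mono a b ha hab := Real.log_le_log (by linarith) (by linarith)
  slope a b ha hab := by
    rw [← Real.log_div (by linarith) (by linarith)]
    refine (Real.log_le_sub_one_of_pos (by apply div_pos <;> linarith)).trans (le_of_eq ?_)
    have : 1 + a ≠ 0 := by linarith
    field_simp
    ring
  w_nonneg a ha := by positivity
  w_le_one a ha := inv_le_one_of_one_le₀ (by linarith)

/-- The total energy of the rotation grows at most like the total rotation angle. -/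
def RotationProfile.Admissible (P : RotationProfile) (M : Model d V) : Prop :=
  ∃ C : ℝ, 0 ≤ C ∧ ∀ (Λ : Finset V) (x : V) (r : ℝ), 0 ≤ r →
    ∑ u ∈ Λ, P.density r (M.siteDist u x) ≤ C * (P.ψ r + 1)

theorem Model.admissible_linear (M : Model 1 V) : RotationProfile.linear.Admissible M := by
  obtain ⟨K, hK0, hK⟩ := M.exists_card_le
  refine ⟨K, hK0, fun Λ x r hr => ?_⟩
  have h := hK (Λ.filter fun u => M.siteDist u x < r) x r hr
    fun v hv => (Finset.mem_filter.mp hv).2.le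
  simp only [RotationProfile.density, RotationProfile.linear, one_pow, Finset.sum_boole]
  linarith [h]

/-- Each dyadic shell contributes a bounded amount, and there are about `log r` of them. -/
theorem Model.admissible_logarithmic (M : Model 2 V) :
    RotationProfile.logarithmic.Admissible M := by
  obtain ⟨K, hK0, hK⟩ := M.exists_card_le
  refine ⟨8 * K, by positivity, fun Λ x r hr => ?_⟩
  obtain ⟨J, hJ1, hJ2⟩ := exists_nat_pow_near (show 1 ≤ 1 + r by linarith) (one_lt_two (α := ℝ))
  have hshell : ∀ u, RotationProfile.logarithmic.density r (M.siteDist u x) ≤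
      ∑ j ∈ Finset.range (J + 1),
        if M.siteDist u x ≤ 2 ^ (j + 1) - 1 then ((4 : ℝ) ^ j)⁻¹ else 0 := by
    intro u
    have hnn : ∀ j ∈ Finset.range (J + 1),
        0 ≤ if M.siteDist u x ≤ 2 ^ (j + 1) - 1 then ((4 : ℝ) ^ j)⁻¹ else 0 := fun j _ => by
      split_ifs <;> positivity
    unfold RotationProfile.density
    split_ifs with hu
    · have hu0 := M.siteDist_nonneg u x
      obtain ⟨j, hj1, hj2⟩ := exists_nat_pow_near
        (show 1 ≤ 1 + M.siteDist u x by linarith) (one_lt_two (α := ℝ))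
      have hjJ : j < J + 1 := by
        have : (2 : ℝ) ^ j < 2 ^ (J + 1) := by linarith
        exact (pow_lt_pow_iff_right₀ one_lt_two).mp this
      refine le_trans ?_ (Finset.single_le_sum hnn (Finset.mem_range.mpr hjJ))
      rw [if_pos (by linarith)]
      simp only [RotationProfile.logarithmic]
      rw [inv_pow]
      refine inv_anti₀ (by positivity) ?_
      calc (4 : ℝ) ^ j = (2 ^ j) ^ 2 := by rw [← pow_mul, mul_comm, pow_mul]; norm_num
        _ ≤ _ := by gcongr
    · exact Finset.sum_nonneg hnn
  have hJlog : (J : ℝ) ≤ 2 * Real.log (1 + r) := by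
    have h := Real.log_le_log (by positivity) hJ1
    rw [Real.log_pow] at h
    have h2 := Real.log_two_gt_d9
    nlinarith [Nat.cast_nonneg (α := ℝ) J]
  calc ∑ u ∈ Λ, RotationProfile.logarithmic.density r (M.siteDist u x)
      ≤ ∑ u ∈ Λ, ∑ j ∈ Finset.range (J + 1),
        (if M.siteDist u x ≤ 2 ^ (j + 1) - 1 then ((4 : ℝ) ^ j)⁻¹ else 0) :=
        Finset.sum_le_sum fun u _ => hshell u
    _ = ∑ j ∈ Finset.range (J + 1),
        ((Λ.filter fun u => M.siteDist u x ≤ 2 ^ (j + 1) - 1).card : ℝ) * ((4 : ℝ) ^ j)⁻¹ := by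
        rw [Finset.sum_comm]
        refine Finset.sum_congr rfl fun j _ => ?_
        rw [← Finset.sum_filter, Finset.sum_const, nsmul_eq_mul]
    _ ≤ ∑ j ∈ Finset.range (J + 1), 4 * K := by
        refine Finset.sum_le_sum fun j _ => ?_
        have h := hK (Λ.filter fun u => M.siteDist u x ≤ 2 ^ (j + 1) - 1) x (2 ^ (j + 1) - 1)
          (sub_nonneg.mpr (one_le_pow₀ one_le_two)) fun v hv => (Finset.mem_filter.mp hv).2
        have h4 : (1 + ((2 : ℝ) ^ (j + 1) - 1)) ^ 2 = 4 * 4 ^ j := by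
          rw [add_sub_cancel, ← pow_mul, mul_comm (j + 1), pow_mul, pow_succ]; norm_num; ring
        rw [h4] at h
        rw [← div_eq_mul_inv, div_le_iff₀ (by positivity)]
        linarith
    _ = 4 * K * (J + 1) := by simp; ring
    _ ≤ 4 * K * (2 * Real.log (1 + r) + 2) := by gcongr; linarith
    _ = 8 * K * (RotationProfile.logarithmic.ψ r + 1) := by
        simp only [RotationProfile.logarithmic]; ring

end Hubbard

/-! ### The thermodynamic limit -/

namespace Hubbard

variable {d : ℕ} {V : Type*}

/-- In all but finitely many of the systems, every bond with a site in a given ball has the hopping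
amplitude of the model. -/
theorem FiniteVolumes.eventually_t_eq {M : Model d V} (F : FiniteVolumes M) (x : V) (r : ℝ) :
    ∀ᶠ n in atTop, ∀ u, M.siteDist u x < r → ∀ v ∈ F.Λ n, F.t n u v = M.t u v :=
  (Filter.eventually_all_finite (M.finite_siteDist_lt x r)).mpr fun u _ => F.t_bulk u

open Classical in
/-- The bound of both correlations by the rotation around `x` that ends at the distance of `y`, for
a rotation strength that makes the energy cost at most half of the gain. -/
theorem Model.exists_eventually_norm_corr_le (M : Model d V) (hM : M.FiniteRange)
    (P : RotationProfile) (hP : P.Admissible M) :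
    ∃ a : ℝ, 0 < a ∧ ∀ β : ℝ, 0 < β → ∀ x y : V, 1 ≤ P.ψ (M.siteDist x y) →
      ∀ F : FiniteVolumes M, ∀ᶠ n in atTop,
        ‖F.pairCorr β x y n‖ ≤ 2 * Real.exp (-(a * decayRate β * P.ψ (M.siteDist x y))) ∧
        ‖F.spinCorr β x y n‖ ≤ 2 * Real.exp (-(a * decayRate β * P.ψ (M.siteDist x y))) := by
  obtain ⟨R₀, T₀, hRT⟩ := hM
  obtain ⟨K, hK0, hK⟩ := M.exists_card_le
  obtain ⟨C, hC0, hC⟩ := hP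
  set R := max R₀ 0
  set T := max T₀ 0
  have hR : 0 ≤ R := le_max_right _ _
  have hT : 0 ≤ T := le_max_right _ _
  set N := K * (1 + R) ^ d
  have hN : 0 ≤ N := by positivity
  set B := 8 * T * N * R ^ 2 * C with hB
  have hB0 : 0 ≤ B := by positivity
  -- The first bound on `a` makes `cosh (κ R)` at most the root of `1 + 1 / β`, the second one
  -- makes the cost at most `κ ψ r`.
  set a := min (1 / (2 * (R + 1))) (1 / (B + 1))
  have ha : 0 < a := lt_min (by positivity) (by positivity)
  have haR : a * R ≤ 1 / 2 := by
    have h1 : a * (2 * (R + 1)) ≤ 1 :=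
      (le_div_iff₀ (by positivity)).mp (min_le_left _ _)
    linarith
  have haB : a * B ≤ 1 := by
    have h1 : a * (B + 1) ≤ 1 := (le_div_iff₀ (by positivity)).mp (min_le_right _ _)
    linarith
  refine ⟨a, ha, fun β hβ x y hψ F => ?_⟩
  set r := M.siteDist x y
  have hr : 0 ≤ r := M.siteDist_nonneg x y
  set κ := a * decayRate β
  have hκ : 0 < κ := mul_pos ha (decayRate_pos hβ)
  have hcosh := mul_decayRate_mul_cosh_le ha.le hR haR hβ
  have hRT' : ∀ u v, u ≠ v → |M.t u v| ≤ T ∧ (R < M.siteDist u v → M.t u v = 0) := fun u v huv =>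
    ⟨(hRT u v huv).1.trans (le_max_left _ _),
      fun h => (hRT u v huv).2 ((le_max_left _ _).trans_lt h)⟩
  filter_upwards [F.eventually_t_eq x r] with n hn
  set φ : V → ℝ := fun u => P.angle κ r (M.siteDist u x) with hφ
  have hφx : φ x = -(κ * P.ψ r) := by
    simp only [hφ]
    rw [M.siteDist_self, RotationProfile.angle, min_eq_left hr, P.ψ_zero]
    ring
  have hφy : φ y = 0 := by
    simp only [hφ]
    rw [M.siteDist_comm, RotationProfile.angle, min_self, sub_self, mul_zero]
  have hcost : ∑ u ∈ F.Λ n, ∑ v ∈ F.Λ n, |F.t n u v| * (Real.cosh (φ u - φ v) - 1) ≤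
      2 * T * N * (κ ^ 2 * R ^ 2 * Real.cosh (κ * R)) * (C * (P.ψ r + 1)) := by
    refine (M.sum_cosh_angle_le (N := N) (R := R) hκ.le hT P x (F.Λ n) (F.t_symm n) ?_ ?_).trans ?_
    · intro u _ v hv hur huv
      rw [hn u hur v hv]
      exact hRT' u v huv
    · intro u _
      exact hK _ u R hR fun v hv => (Finset.mem_filter.mp hv).2
    · have := Real.cosh_pos (κ * R)
      gcongr
      exact hC (F.Λ n) x r hr
  have hexp : 2 * (φ x - φ y) + 2 * β * ∑ u : F.Λ n, ∑ v : F.Λ n,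
      |F.t n u v| * (Real.cosh (φ u - φ v) - 1) ≤ -(κ * P.ψ r) := by
    have e1 : ∑ u : F.Λ n, ∑ v : F.Λ n, |F.t n u v| * (Real.cosh (φ u - φ v) - 1) =
        ∑ u ∈ F.Λ n, ∑ v ∈ F.Λ n, |F.t n u v| * (Real.cosh (φ u - φ v) - 1) := by
      rw [← Finset.sum_coe_sort (F.Λ n)]
      refine Finset.sum_congr rfl fun u _ => ?_
      rw [← Finset.sum_coe_sort (F.Λ n)]
    have e2 : 2 * β * (2 * T * N * (κ ^ 2 * R ^ 2 * Real.cosh (κ * R)) * (C * (P.ψ r + 1))) ≤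
        κ * P.ψ r := by
      calc 2 * β * (2 * T * N * (κ ^ 2 * R ^ 2 * Real.cosh (κ * R)) * (C * (P.ψ r + 1)))
          = B / 2 * κ * (P.ψ r + 1) * (β * κ * Real.cosh (κ * R)) := by rw [hB]; ring
        _ ≤ B / 2 * κ * (P.ψ r + P.ψ r) * a := by gcongr
        _ = a * B * (κ * P.ψ r) := by ring
        _ ≤ 1 * (κ * P.ψ r) := by gcongr
        _ = κ * P.ψ r := one_mul _
    rw [e1, hφx, hφy]
    have := mul_le_mul_of_nonneg_left hcost (show 0 ≤ 2 * β by positivity)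
    linarith
  have hsymm : ∀ u v : F.Λ n, F.t n u v = F.t n v u := fun u v => F.t_symm n u v
  constructor
  · unfold FiniteVolumes.pairCorr
    split_ifs with h
    · refine (norm_canonicalAverage_pairOp_le hsymm _ _ hβ.le (fun u : F.Λ n => φ u) _ _).trans ?_
      gcongr
    · rw [norm_zero]; positivity
  · unfold FiniteVolumes.spinCorr
    split_ifs with h
    · refine (norm_canonicalAverage_spinDot_le hsymm _ _ hβ.le (fun u : F.Λ n => φ u) _ _).trans ?_
      gcongr
    · rw [norm_zero]; positivity

theorem FiniteVolumes.IsThermodynamicLimit.norm_le {u : ℕ → ℂ} {L : ℂ} {C : ℝ}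
    (hL : IsThermodynamicLimit u L) (hu : ∀ᶠ n in atTop, ‖u n‖ ≤ C) : ‖L‖ ≤ C := by
  by_contra! h
  obtain ⟨n, hn, hn'⟩ :=
    ((hL.frequently (continuous_norm.continuousAt.eventually_const_lt h)).and_eventually hu).exists
  exact hn.not_ge hn'

/-- Half of the decay rate absorbs the constant prefactor at large distances. -/
theorem Model.exists_norm_limit_le (M : Model d V) (hM : M.FiniteRange)
    (P : RotationProfile) (hP : P.Admissible M) (hψ : Tendsto P.ψ atTop atTop) :
    ∃ α : ℝ, 0 < α ∧ ∀ β : ℝ, 0 < β → ∃ r₀ : ℝ, 1 ≤ r₀ ∧ ∀ x y : V, r₀ ≤ M.siteDist x y →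
      ∀ F : FiniteVolumes M,
        (∀ L : ℂ, FiniteVolumes.IsThermodynamicLimit (F.pairCorr β x y) L →
          ‖L‖ ≤ Real.exp (-(α * decayRate β * P.ψ (M.siteDist x y)))) ∧
        (∀ L : ℂ, FiniteVolumes.IsThermodynamicLimit (F.spinCorr β x y) L →
          ‖L‖ ≤ Real.exp (-(α * decayRate β * P.ψ (M.siteDist x y)))) := by
  obtain ⟨a, ha, hbound⟩ := M.exists_eventually_norm_corr_le hM P hP
  refine ⟨a / 2, by positivity, fun β hβ => ?_⟩
  have hf := decayRate_pos hβ
  obtain ⟨r₁, hr₁⟩ := (hψ.eventually_ge_atTop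
    (max 1 (Real.log 2 / (a / 2 * decayRate β)))).exists_forall_of_atTop
  refine ⟨max 1 r₁, le_max_left _ _, fun x y hxy F => ?_⟩
  have h := hr₁ _ ((le_max_right _ _).trans hxy)
  have h1 := (le_max_left _ _).trans h
  have h2 : Real.log 2 ≤ a / 2 * decayRate β * P.ψ (M.siteDist x y) := by
    have := (div_le_iff₀ (by positivity)).mp ((le_max_right _ _).trans h)
    linarith
  have h3 : 2 * Real.exp (-(a * decayRate β * P.ψ (M.siteDist x y))) ≤
      Real.exp (-(a / 2 * decayRate β * P.ψ (M.siteDist x y))) := by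
    rw [← Real.exp_log (zero_lt_two' ℝ), ← Real.exp_add, Real.exp_log (zero_lt_two' ℝ)]
    exact Real.exp_le_exp.mpr (by linarith)
  have hn := hbound β hβ x y h1 F
  exact ⟨fun L hL => (hL.norm_le (hn.mono fun n hn => hn.1)).trans h3,
    fun L hL => (hL.norm_le (hn.mono fun n hn => hn.2)).trans h3⟩

end Hubbard

end

theorem mainTheorem7 {d : ℕ} (hd : d = 1 ∨ d = 2) {V : Type*} (M : Hubbard.Model d V)
    (hM : M.FiniteRange) :
    ∃ (α γ δ : ℝ) (f : ℝ → ℝ), 0 < α ∧ 0 < γ ∧ 0 < δ ∧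
      StrictAntiOn f (Set.Ioi 0) ∧
      f ~[atTop] (fun β => 1 / β) ∧
      f ~[𝓝[>] 0] (fun β => 2 / δ * |Real.log β|) ∧
      ∀ β : ℝ, 0 < β → ∃ r₀ : ℝ, ∀ x y : V, r₀ ≤ M.siteDist x y →
        ∀ F : Hubbard.FiniteVolumes M,
          (∀ L : ℂ, Hubbard.FiniteVolumes.IsThermodynamicLimit (F.pairCorr β x y) L →
            (d = 2 → ‖L‖ ≤ M.siteDist x y ^ (-(α * f β))) ∧
            (d = 1 → ‖L‖ ≤ Real.exp (-(γ * f β * M.siteDist x y)))) ∧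
          (∀ L : ℂ, Hubbard.FiniteVolumes.IsThermodynamicLimit (F.spinCorr β x y) L →
            (d = 2 → ‖L‖ ≤ M.siteDist x y ^ (-(α * f β))) ∧
            (d = 1 → ‖L‖ ≤ Real.exp (-(γ * f β * M.siteDist x y)))) := by
  suffices h : ∃ α : ℝ, 0 < α ∧ ∀ β : ℝ, 0 < β → ∃ r₀ : ℝ, ∀ x y : V, r₀ ≤ M.siteDist x y →
      ∀ F : Hubbard.FiniteVolumes M,
        (∀ L : ℂ, Hubbard.FiniteVolumes.IsThermodynamicLimit (F.pairCorr β x y) L →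
          (d = 2 → ‖L‖ ≤ M.siteDist x y ^ (-(α * Hubbard.decayRate β))) ∧
          (d = 1 → ‖L‖ ≤ Real.exp (-(α * Hubbard.decayRate β * M.siteDist x y)))) ∧
        (∀ L : ℂ, Hubbard.FiniteVolumes.IsThermodynamicLimit (F.spinCorr β x y) L →
          (d = 2 → ‖L‖ ≤ M.siteDist x y ^ (-(α * Hubbard.decayRate β))) ∧
          (d = 1 → ‖L‖ ≤ Real.exp (-(α * Hubbard.decayRate β * M.siteDist x y)))) by
    obtain ⟨α, hα, h⟩ := h
    exact ⟨α, α, 2, Hubbard.decayRate, hα, hα, two_pos, Hubbard.strictAntiOn_decayRate,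
      Hubbard.decayRate_isEquivalent_atTop, Hubbard.decayRate_isEquivalent_zero, h⟩
  rcases hd with rfl | rfl
  · obtain ⟨α, hα, h⟩ := M.exists_norm_limit_le hM .linear M.admissible_linear tendsto_id
    refine ⟨α, hα, fun β hβ => ?_⟩
    obtain ⟨r₀, -, hr₀⟩ := h β hβ
    refine ⟨r₀, fun x y hxy F => ?_⟩
    obtain ⟨h1, h2⟩ := hr₀ x y hxy F
    exact ⟨fun L hL => ⟨fun h => absurd h (by norm_num), fun _ => h1 L hL⟩,
      fun L hL => ⟨fun h => absurd h (by norm_num), fun _ => h2 L hL⟩⟩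
  · obtain ⟨α, hα, h⟩ := M.exists_norm_limit_le hM .logarithmic M.admissible_logarithmic
      (Real.tendsto_log_atTop.comp (tendsto_atTop_add_const_left _ _ tendsto_id))
    refine ⟨α, hα, fun β hβ => ?_⟩
    obtain ⟨r₀, hr1, hr₀⟩ := h β hβ
    refine ⟨r₀, fun x y hxy F => ?_⟩
    obtain ⟨h1, h2⟩ := hr₀ x y hxy F
    have hr : 0 < M.siteDist x y := by linarith
    have hle : Real.exp (-(α * Hubbard.decayRate β *
        Hubbard.RotationProfile.logarithmic.ψ (M.siteDist x y))) ≤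
        M.siteDist x y ^ (-(α * Hubbard.decayRate β)) := by
      rw [Real.rpow_def_of_pos hr]
      refine Real.exp_le_exp.mpr ?_
      have hlog : Real.log (M.siteDist x y) ≤ Real.log (1 + M.siteDist x y) :=
        Real.log_le_log hr (by linarith)
      have := mul_le_mul_of_nonneg_left hlog (mul_pos hα (Hubbard.decayRate_pos hβ)).le
      simp only [Hubbard.RotationProfile.logarithmic]
      linarith
    exact ⟨fun L hL => ⟨fun _ => (h1 L hL).trans hle, fun h => absurd h (by norm_num)⟩,
      fun L hL => ⟨fun _ => (h2 L hL).trans hle, fun h => absurd h (by norm_num)⟩⟩
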